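/- Let $d\ge 0$ be an integer, let $\mathbb F_d^*$ be the free unital semigroup on $d$ generators, with unit $\varnothing$ and word length $|w|$, and let $\ell^2(\mathbb F_d^*)$ be the Fock space with orthonormal basis $\{\xi_w : w\in\mathbb F_d^*\}$. Let $\mathcal L_d\subseteq B(\ell^2(\mathbb F_d^*))$ be the unital WOT-closed algebra generated by the isometries $L_u\xi_w=\xi_{uw}$ ($u,w\in\mathbb F_d^*$). Let $\mathcal J$ be a homogeneous ideal of $\mathcal L_d$, i.e. the WOT-closed two-sided ideal generated by a set of homogeneous polynomials (elements of $\operatorname{span}\{L_w:|w|=n\}$ for some $n$). Put $\mathcal N_{\mathcal J}=(\mathcal J\xi_\varnothing)^\perp$, $\pi(A)=P_{\mathcal N_{\mathcal J}}A|_{\mathcal N_{\mathcal J}}$, and let $\mathcal L_{\mathcal J}=\pi(\mathcal L_d)\subseteq B(\mathcal N_{\mathcal J})$ be the compression algebra. For $k\ge1$ and $A\in\mathcal L_d$ let $$\Sigma_k(A)=\sum_{|w|<k}\Big(1-\frac{|w|}{k}\Big)(A\xi_\varnothing,\xi_w)\,L_w .$$ Theorem. The subspace $\mathcal L_{\mathcal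 J}$ of $B(\mathcal N_{\mathcal J})$ is weak*-closed, and the following hold. 1. For each $k\ge 1$ there is a linear map $\widehat\Sigma_k:\mathcal L_{\mathcal J}\to\mathcal L_{\mathcal J}$ with $\widehat\Sigma_k(\pi(A))=\pi(\Sigma_k(A))$ for all $A\in\mathcal L_d$; each $\widehat\Sigma_k$ is completely contractive, weak*-continuous and of finite rank, and $\widehat\Sigma_k(B)\to B$ in the weak* topology for every $B\in\mathcal L_{\mathcal J}$. 2. Hence $\mathcal L_{\mathcal J}$ has the completely contractive approximation property: there is a net of completely contractive weak*-continuous finite rank maps $\Phi_i:\mathcal L_{\mathcal J}\to\mathcal L_{\mathcal J}$ with $\Phi_i(B)\to B$ weak* for every $B\in\mathcal L_{\mathcal J}$. 3. Moreover, $\mathcal L_{\mathcal J}$ has property $S_\sigma$: for every Hilbert space $\mathcal K$ and every weak*-closed subspace $\mathcal T\subseteq B(\mathcal K)$, $$\mathcal L_{\mathcal J}\otimes_{\mathcal F}\mathcal T=\mathcal L_{\mathcal J}\,\overline\otimes\,\mathcal T .$$ Here $\mathcal L_{\mathcal J}\,\overline\otimes\,\mathcal T$ is the weak*-closed linear span of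 $\{A\otimes B: A\in\mathcal L_{\mathcal J},\,B\in\mathcal T\}$ in $B(\mathcal N_{\mathcal J}\otimes\mathcal K)$. The Fubini tensor product $\mathcal L_{\mathcal J}\otimes_{\mathcal F}\mathcal T$ is the set of all $X\in B(\mathcal N_{\mathcal J}\otimes\mathcal K)$ such that $(\varphi\otimes\mathrm{id})(X)\in\mathcal T$ for every weak*-continuous linear functional $\varphi$ on $B(\mathcal N_{\mathcal J})$ and $(\mathrm{id}\otimes\psi)(X)\in\mathcal L_{\mathcal J}$ for every weak*-continuous linear functional $\psi$ on $B(\mathcal K)$. -/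

import Mathlib

open scoped TensorProduct Topology

universe u v

noncomputable section

/-! ### The weak operator topology and the weak* topology on `B(H)` -/

section Topologies

variable {H : Type u} [NormedAddCommGroup H] [InnerProductSpace ℂ H]

/-- A set of operators is closed in the weak operator topology. -/
def IsWOTClosed (S : Set (H →L[ℂ] H)) : Prop :=
  IsClosed (ContinuousLinearMapWOT.toCLM ⁻¹' S : Set (H →WOT[ℂ] H))

/-- The normal functional `A ↦ ∑ₙ (A xₙ, yₙ)` attached to two square-summable sequences of vectors.
Every functional in the predual `B(H)_*` is of this form. -/
def normalFunctional (x y : lp (fun _ : ℕ => H) 2) (A : H →L[ℂ] H) : ℂ :=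
  ∑' n, inner ℂ (y n) (A (x n))

/-- The series that defines `normalFunctional` converges absolutely. -/
theorem summable_normalFunctional (x y : lp (fun _ : ℕ => H) 2) (A : H →L[ℂ] H) :
    Summable fun n => ‖inner ℂ (y n) (A (x n))‖ := by
  have hx : Summable fun n => ‖x n‖ ^ 2 := by
    simpa using (lp.memℓp x).summable (by norm_num)
  have hy : Summable fun n => ‖y n‖ ^ 2 := by
    simpa using (lp.memℓp y).summable (by norm_num)
  refine Summable.of_nonneg_of_le (fun n => norm_nonneg _) (fun n => ?_)
    ((hx.add hy).mul_left ‖A‖)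
  have h1 := norm_inner_le_norm (𝕜 := ℂ) (y n) (A (x n))
  have h2 := A.le_opNorm (x n)
  have h3 : ‖y n‖ * ‖A (x n)‖ ≤ ‖y n‖ * (‖A‖ * ‖x n‖) := by gcongr
  nlinarith [mul_nonneg (norm_nonneg A) (sq_nonneg (‖x n‖ - ‖y n‖)),
    mul_nonneg (norm_nonneg A) (sq_nonneg (‖x n‖ + ‖y n‖))]

/-- The weak* (that is, ultraweak) topology on `B(H)`: the coarsest topology in which all normal
functionals are continuous. -/
@[reducible] def weakStar (H : Type u) [NormedAddCommGroup H] [InnerProductSpace ℂ H] :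
    TopologicalSpace (H →L[ℂ] H) :=
  ⨅ (x : lp (fun _ : ℕ => H) 2) (y : lp (fun _ : ℕ => H) 2),
    TopologicalSpace.induced (normalFunctional x y) inferInstance

/-- The weak* topology of `B(H)` restricted to a subspace `S`. -/
@[reducible] def weakStarOn (S : Submodule ℂ (H →L[ℂ] H)) : TopologicalSpace S :=
  TopologicalSpace.induced Subtype.val (weakStar H)

end Topologies

/-! ### Completely contractive maps and the CCAP -/

section CCAP

variable {H : Type u} [NormedAddCommGroup H] [InnerProductSpace ℂ H]

/-- The operator on `Hⁿ = H ⊕ ⋯ ⊕ H` (Hilbert space direct sum) given by an `n × n` matrix of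
operators on `H`. -/
def matrixOperator {n : ℕ} (A : Matrix (Fin n) (Fin n) (H →L[ℂ] H)) :
    PiLp 2 (fun _ : Fin n => H) →L[ℂ] PiLp 2 (fun _ : Fin n => H) :=
  ((PiLp.continuousLinearEquiv 2 ℂ (fun _ : Fin n => H)).symm :
      (Fin n → H) →L[ℂ] PiLp 2 (fun _ : Fin n => H)) ∘L
    ContinuousLinearMap.pi fun i => ∑ j, A i j ∘L PiLp.proj 2 (fun _ : Fin n => H) j

theorem matrixOperator_apply {n : ℕ} (A : Matrix (Fin n) (Fin n) (H →L[ℂ] H))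
    (x : PiLp 2 (fun _ : Fin n => H)) (i : Fin n) :
    matrixOperator A x i = ∑ j, A i j (x j) := by
  simp [matrixOperator]

/-- `Φ : S → S` is completely contractive: all its matrix amplifications
`Mₙ(S) → Mₙ(S) ⊆ B(Hⁿ)` are contractive. -/
def IsCompletelyContractive {S : Submodule ℂ (H →L[ℂ] H)} (Φ : S →ₗ[ℂ] S) : Prop :=
  ∀ (n : ℕ) (A : Matrix (Fin n) (Fin n) S),
    ‖matrixOperator fun i j => (Φ (A i j) : H →L[ℂ] H)‖ ≤
      ‖matrixOperator fun i j => (A i j : H →L[ℂ] H)‖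

/-- `Φ : S → S` is a completely contractive, weak*-continuous map of finite rank. -/
structure IsCCFiniteRankNormal {S : Submodule ℂ (H →L[ℂ] H)} (Φ : S →ₗ[ℂ] S) : Prop where
  completelyContractive : IsCompletelyContractive Φ
  weakStarContinuous : Continuous[weakStarOn S, weakStarOn S] Φ
  finiteRank : FiniteDimensional ℂ (LinearMap.range Φ)

/-- The completely contractive approximation property of a (weak*-closed) subspace `S ⊆ B(H)`:
there is a net of completely contractive weak*-continuous finite rank maps on `S` that converges
to the identity in the point-weak* topology. -/
def HasCCAP (S : Submodule ℂ (H →L[ℂ] H)) : Prop :=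
  ∃ (ι : Type u) (_ : Preorder ι) (_ : IsDirectedOrder ι) (_ : Nonempty ι)
    (Φ : ι → S →ₗ[ℂ] S),
    (∀ i, IsCCFiniteRankNormal (Φ i)) ∧
    ∀ A : S, Filter.Tendsto (fun i => (Φ i A : H →L[ℂ] H)) Filter.atTop
      (@nhds _ (weakStar H) (A : H →L[ℂ] H))

end CCAP

/-! ### Tensor products and property `S_σ` -/

section Tensor

variable {H : Type u} [NormedAddCommGroup H] [InnerProductSpace ℂ H]
variable {K : Type v} [NormedAddCommGroup K] [InnerProductSpace ℂ K]

/-- The Hilbert space tensor product of `H` and `K`. -/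
abbrev HilbertTensor (H : Type u) [NormedAddCommGroup H] [InnerProductSpace ℂ H]
    (K : Type v) [NormedAddCommGroup K] [InnerProductSpace ℂ K] : Type (max u v) :=
  UniformSpace.Completion (H ⊗[ℂ] K)

/-- The operator `A ⊗ B` on the Hilbert space tensor product. -/
def tensorOperator (A : H →L[ℂ] H) (B : K →L[ℂ] K) :
    HilbertTensor H K →L[ℂ] HilbertTensor H K :=
  (TensorProduct.mapL A B).completion

/-- The map `k ↦ x ⊗ k` from `K` to the Hilbert space tensor product. -/
def tensorLeft (x : H) : K →L[ℂ] HilbertTensor H K :=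
  UniformSpace.Completion.toComplL ∘L TensorProduct.mkL ℂ H K x

/-- The map `h ↦ h ⊗ k` from `H` to the Hilbert space tensor product. -/
def tensorRight (k : K) : H →L[ℂ] HilbertTensor H K :=
  UniformSpace.Completion.toComplL ∘L (TensorProduct.mkL ℂ H K).flip k

/-- The normal tensor product of `S` and `T`: the weak*-closed linear span in `B(H ⊗ K)` of the
operators `A ⊗ B` with `A ∈ S` and `B ∈ T`. -/
def normalTensorProduct (S : Submodule ℂ (H →L[ℂ] H)) (T : Submodule ℂ (K →L[ℂ] K)) :
    Set (HilbertTensor H K →L[ℂ] HilbertTensor H K) :=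
  @closure _ (weakStar (HilbertTensor H K))
    (Submodule.span ℂ {X | ∃ A ∈ S, ∃ B ∈ T, X = tensorOperator A B} : Set _)

theorem norm_tensorLeft_le (x : H) : ‖tensorLeft (K := K) x‖ ≤ ‖x‖ :=
  ContinuousLinearMap.opNorm_le_bound _ (norm_nonneg _) fun k => by
    simp [tensorLeft, TensorProduct.mkL_apply_apply]

theorem norm_tensorRight_le (k : K) : ‖tensorRight (H := H) k‖ ≤ ‖k‖ :=
  ContinuousLinearMap.opNorm_le_bound _ (norm_nonneg _) fun h => by
    simp [tensorRight, TensorProduct.mkL_apply_apply, mul_comm]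

variable [CompleteSpace H] [CompleteSpace K]

theorem summable_norm_slice {E F G : Type*} [NormedAddCommGroup E]
    [NormedAddCommGroup F] [InnerProductSpace ℂ F] [CompleteSpace F]
    [NormedAddCommGroup G] [InnerProductSpace ℂ G] [CompleteSpace G]
    (x y : lp (fun _ : ℕ => E) 2) (X : G →L[ℂ] G) (V W : E → F →L[ℂ] G)
    (hV : ∀ e, ‖V e‖ ≤ ‖e‖) (hW : ∀ e, ‖W e‖ ≤ ‖e‖) :
    Summable fun n => ‖(V (y n)).adjoint ∘L X ∘L W (x n)‖ := by
  have hx : Summable fun n => ‖x n‖ ^ 2 := by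
    simpa using (lp.memℓp x).summable (by norm_num)
  have hy : Summable fun n => ‖y n‖ ^ 2 := by
    simpa using (lp.memℓp y).summable (by norm_num)
  refine Summable.of_nonneg_of_le (fun n => norm_nonneg _) (fun n => ?_)
    ((hx.add hy).mul_left ‖X‖)
  have h1 : ‖(V (y n)).adjoint ∘L X ∘L W (x n)‖ ≤ ‖y n‖ * (‖X‖ * ‖x n‖) := by
    refine (ContinuousLinearMap.opNorm_comp_le _ _).trans ?_
    rw [LinearIsometryEquiv.norm_map]
    refine mul_le_mul (hV _) ((ContinuousLinearMap.opNorm_comp_le _ _).trans ?_)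
      (norm_nonneg _) (norm_nonneg _)
    exact mul_le_mul_of_nonneg_left (hW _) (norm_nonneg _)
  nlinarith [mul_nonneg (norm_nonneg X) (sq_nonneg (‖x n‖ - ‖y n‖)),
    mul_nonneg (norm_nonneg X) (sq_nonneg (‖x n‖ + ‖y n‖))]

/-- The slice map `B(H ⊗ K) → B(K)` of the normal functional `φ = normalFunctional x y` on `B(H)`;
it is the weak*-continuous linear map with `A ⊗ B ↦ φ(A) B`. -/
def sliceRight (x y : lp (fun _ : ℕ => H) 2)
    (X : HilbertTensor H K →L[ℂ] HilbertTensor H K) : K →L[ℂ] K :=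
  ∑' n, (tensorLeft (K := K) (y n)).adjoint ∘L X ∘L tensorLeft (x n)

/-- The slice map `B(H ⊗ K) → B(H)` of the normal functional `ψ = normalFunctional x y` on `B(K)`;
it is the weak*-continuous linear map with `A ⊗ B ↦ ψ(B) A`. -/
def sliceLeft (x y : lp (fun _ : ℕ => K) 2)
    (X : HilbertTensor H K →L[ℂ] HilbertTensor H K) : H →L[ℂ] H :=
  ∑' n, (tensorRight (H := H) (y n)).adjoint ∘L X ∘L tensorRight (x n)

/-- The series that defines `sliceRight` converges absolutely in norm. -/
theorem summable_sliceRight (x y : lp (fun _ : ℕ => H) 2)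
    (X : HilbertTensor H K →L[ℂ] HilbertTensor H K) :
    Summable fun n => ‖(tensorLeft (K := K) (y n)).adjoint ∘L X ∘L tensorLeft (x n)‖ :=
  summable_norm_slice x y X _ _ norm_tensorLeft_le norm_tensorLeft_le

/-- The series that defines `sliceLeft` converges absolutely in norm. -/
theorem summable_sliceLeft (x y : lp (fun _ : ℕ => K) 2)
    (X : HilbertTensor H K →L[ℂ] HilbertTensor H K) :
    Summable fun n => ‖(tensorRight (H := H) (y n)).adjoint ∘L X ∘L tensorRight (x n)‖ :=
  summable_norm_slice x y X _ _ norm_tensorRight_le norm_tensorRight_le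

/-- The Fubini tensor product of `S` and `T`: all operators on `H ⊗ K` whose slices by normal
functionals lie in `T` and in `S`. -/
def fubiniTensorProduct (S : Submodule ℂ (H →L[ℂ] H)) (T : Submodule ℂ (K →L[ℂ] K)) :
    Set (HilbertTensor H K →L[ℂ] HilbertTensor H K) :=
  {X | (∀ x y : lp (fun _ : ℕ => H) 2, sliceRight x y X ∈ T) ∧
    ∀ x y : lp (fun _ : ℕ => K) 2, sliceLeft x y X ∈ S}

/-- Property `S_σ` of a (weak*-closed) subspace `S ⊆ B(H)`: the Fubini and the normal tensor product
of `S` with every weak*-closed subspace `T ⊆ B(K)`, for every Hilbert space `K`, coincide. -/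
def HasPropertySSigma (S : Submodule ℂ (H →L[ℂ] H)) : Prop :=
  ∀ (K : Type v) [NormedAddCommGroup K] [InnerProductSpace ℂ K] [CompleteSpace K]
    (T : Submodule ℂ (K →L[ℂ] K)), IsClosed[weakStar K] (T : Set (K →L[ℂ] K)) →
    fubiniTensorProduct S T = normalTensorProduct S T

end Tensor

/-! ### The free semigroup algebra `L_d` -/

section FreeSemigroup

/-- The Fock space `ℓ²(F_d^*)` over the free unital semigroup on `d` generators. -/
abbrev FockSpace (d : ℕ) : Type := lp (fun _ : FreeMonoid (Fin d) => ℂ) 2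

variable {d : ℕ}

open Classical in
/-- The standard orthonormal basis `ξ_w` of the Fock space. -/
def fockBasis (w : FreeMonoid (Fin d)) : FockSpace d := lp.single 2 w 1

theorem orthonormal_fockBasis_mul (u : FreeMonoid (Fin d)) :
    Orthonormal ℂ fun w => fockBasis (u * w) := by
  classical
  rw [orthonormal_iff_ite]
  intro i j
  simp only [fockBasis, lp.inner_single_left, lp.single_apply, Pi.single_apply]
  by_cases h : i = j <;> simp [h]

/-- The left regular representation: `L_u` is the isometry with `L_u ξ_w = ξ_{uw}`. -/
def leftRegular (u : FreeMonoid (Fin d)) : FockSpace d →L[ℂ] FockSpace d :=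
  (orthonormal_fockBasis_mul u).orthogonalFamily.linearIsometry.toContinuousLinearMap

theorem leftRegular_fockBasis (u w : FreeMonoid (Fin d)) :
    leftRegular u (fockBasis w) = fockBasis (u * w) := by
  simp [leftRegular, fockBasis]

/-- The free semigroup algebra `L_d`: the unital WOT-closed algebra generated by the `L_u`. -/
def freeSemigroupAlgebra (d : ℕ) : Subalgebra ℂ (FockSpace d →L[ℂ] FockSpace d) :=
  sInf {𝒜 | IsWOTClosed (𝒜 : Set (FockSpace d →L[ℂ] FockSpace d)) ∧ ∀ u, leftRegular u ∈ 𝒜}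

/-- WOT-closed two-sided ideals of `L_d`. -/
structure IsWOTClosedIdeal (J : Submodule ℂ (FockSpace d →L[ℂ] FockSpace d)) : Prop where
  mem_algebra : ∀ A ∈ J, A ∈ freeSemigroupAlgebra d
  mul_mem_left : ∀ B ∈ freeSemigroupAlgebra d, ∀ A ∈ J, B * A ∈ J
  mul_mem_right : ∀ B ∈ freeSemigroupAlgebra d, ∀ A ∈ J, A * B ∈ J
  isWOTClosed : IsWOTClosed (J : Set (FockSpace d →L[ℂ] FockSpace d))

/-- `A` is a homogeneous polynomial of degree `n` in the generators of `L_d`. -/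
def IsHomogeneousPolynomial (n : ℕ) (A : FockSpace d →L[ℂ] FockSpace d) : Prop :=
  A ∈ Submodule.span ℂ {B | ∃ w : FreeMonoid (Fin d), w.length = n ∧ B = leftRegular w}

/-- `J` is a homogeneous ideal of `L_d`: it is the WOT-closed two-sided ideal generated by a set of
homogeneous polynomials (possibly of different degrees). -/
def IsHomogeneousIdeal (J : Submodule ℂ (FockSpace d →L[ℂ] FockSpace d)) : Prop :=
  ∃ G : Set (FockSpace d →L[ℂ] FockSpace d),
    (∀ A ∈ G, ∃ n, IsHomogeneousPolynomial n A) ∧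
    IsLeast {I : Submodule ℂ (FockSpace d →L[ℂ] FockSpace d) |
      IsWOTClosedIdeal I ∧ G ⊆ (I : Set (FockSpace d →L[ℂ] FockSpace d))} J

/-- The Fourier coefficient `a_w = (A ξ_∅, ξ_w)`. -/
def wordCoeff (A : FockSpace d →L[ℂ] FockSpace d) (w : FreeMonoid (Fin d)) : ℂ :=
  inner ℂ (fockBasis w) (A (fockBasis 1))

/-- The Cesàro map `Σ_k(A) = ∑_{|w| < k} (1 - |w|/k) a_w L_w`; the inner sum is over the words of
length `n`, listed as functions `Fin n → Fin d`. -/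
def cesaroMap (k : ℕ) (A : FockSpace d →L[ℂ] FockSpace d) : FockSpace d →L[ℂ] FockSpace d :=
  ∑ n ∈ Finset.range k, ∑ v : Fin n → Fin d,
    ((1 - (n : ℂ) / (k : ℂ)) * wordCoeff A (FreeMonoid.ofList (List.ofFn v))) •
      leftRegular (FreeMonoid.ofList (List.ofFn v))

/-! ### The compression algebra `L_J` -/

/-- The coinvariant subspace `N_J = (J ξ_∅)^⊥`. -/
def coinvariantSubspace (J : Submodule ℂ (FockSpace d →L[ℂ] FockSpace d)) :
    Submodule ℂ (FockSpace d) :=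
  (J.map (ContinuousLinearMap.apply ℂ (FockSpace d) (fockBasis (1 : FreeMonoid (Fin d)))).toLinearMap)ᗮ

instance (J : Submodule ℂ (FockSpace d →L[ℂ] FockSpace d)) :
    CompleteSpace (coinvariantSubspace J) := by
  unfold coinvariantSubspace
  infer_instance

/-- The compression map `A ↦ P_{N_J} A |_{N_J}`. -/
def compression (J : Submodule ℂ (FockSpace d →L[ℂ] FockSpace d)) :
    (FockSpace d →L[ℂ] FockSpace d) →ₗ[ℂ] (coinvariantSubspace J →L[ℂ] coinvariantSubspace J) where
  toFun A := (coinvariantSubspace J).orthogonalProjectionOnto ∘L A ∘L (coinvariantSubspace J).subtypeL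
  map_add' A B := by ext; simp
  map_smul' c A := by ext; simp

/-- The compression algebra `L_J = P_{N_J} L_d |_{N_J} ⊆ B(N_J)`. -/
def compressionAlgebra (J : Submodule ℂ (FockSpace d →L[ℂ] FockSpace d)) :
    Submodule ℂ (coinvariantSubspace J →L[ℂ] coinvariantSubspace J) :=
  (freeSemigroupAlgebra d).toSubmodule.map (compression J)

theorem compression_mem (J : Submodule ℂ (FockSpace d →L[ℂ] FockSpace d))
    {A : FockSpace d →L[ℂ] FockSpace d} (hA : A ∈ freeSemigroupAlgebra d) :
    compression J A ∈ compressionAlgebra J :=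
  Submodule.mem_map_of_mem hA

end FreeSemigroup

end

/-! The approximation maps come from the grading by word length. On a Hilbert space graded by
projections `E n`, let `Q_s` be the projection onto the degrees in `(s - k, s]`. The average `(1/k)
∑_s Q_s A Q_s` multiplies the block of `A` in position `(i, j)` by `max (1 - |i - j|/k) 0`, because
exactly that fraction of `k` windows contains both degrees. Since `∑_s Q_s = k`, this average is
completely contractive and normal. The windows with `s < k` are initial partial sums and average to
the identity, while the others contribute a vanishing tail; hence the maps tend to the identity
point-weak*.

An operator commuting with the right shifts `R_u` has blocks depending, apart from the choice of
homogeneous part, only on `i - j`. On it the average is therefore the polynomial `Σ_k(A)`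
(`cesaro_eq_cesaroMap`), and convergence shows that `L_d` is the whole commutant of the `R_u`. A
homogeneous ideal contains the homogeneous parts of its elements, so `N_J` is graded by the
restricted projections, and averaging commutes with compression
(`IsHomogeneousIdeal.cesaro_compression`). This gives the finite rank maps on `L_J`.

Weak*-closedness is a commutant lifting statement: `L_J` is the commutant of the compressed right
shifts (`IsWOTClosedIdeal.mem_compressionAlgebra_iff`), a condition tested by normal functionals. To
lift `B`, the operator `B*` on `N_J` is extended to the Fock space so that it keeps commuting with
the `R_i*`. One step of the extension only has to choose a `ξ_∅`-coordinate, which Hahn–Banach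
supplies with the right bound; Zorn's lemma finishes.

For property `S_σ`, the same averages are formed on `N_J ⊗ K` with the grading `E n ⊗ 1`. They send
a Fubini element to an operator whose left slices lie in a finite-dimensional subspace of `L_J` and
whose right slices lie in `T`. Such an operator is a finite sum of elementary tensors, and the
averages converge weak* to the original element. -/

noncomputable section

/-! ### Normal functionals and the weak* topology -/

section WeakStar

variable {H : Type*} [NormedAddCommGroup H]

/-- A square-summable sequence, as an element of `ℓ²`. -/
def l2Mk (f : ℕ → H) (hf : Summable fun n => ‖f n‖ ^ 2) : lp (fun _ : ℕ => H) 2 :=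
  ⟨f, memℓp_gen (by simpa using hf)⟩

@[simp]
theorem l2Mk_apply (f : ℕ → H) (hf : Summable fun n => ‖f n‖ ^ 2) (n : ℕ) : l2Mk f hf n = f n :=
  rfl

theorem summable_norm_sq (x : lp (fun _ : ℕ => H) 2) : Summable fun n => ‖x n‖ ^ 2 := by
  simpa using (lp.memℓp x).summable (by norm_num)

theorem norm_sq_eq_tsum (x : lp (fun _ : ℕ => H) 2) : ‖x‖ ^ 2 = ∑' n, ‖x n‖ ^ 2 := by
  simpa using lp.norm_rpow_eq_tsum (p := 2) (by norm_num) x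

variable [InnerProductSpace ℂ H]

theorem continuous_normalFunctional (x y : lp (fun _ : ℕ => H) 2) :
    Continuous[weakStar H, inferInstance] (normalFunctional x y) :=
  continuous_iff_le_induced.2 ((iInf_le _ x).trans (iInf_le _ y))

theorem continuous_weakStar_rng {α : Type*} [TopologicalSpace α] {f : α → H →L[ℂ] H}
    (hf : ∀ x y : lp (fun _ : ℕ => H) 2, Continuous fun a => normalFunctional x y (f a)) :
    Continuous[inferInstance, weakStar H] f :=
  continuous_iInf_rng.2 fun x => continuous_iInf_rng.2 fun y => continuous_induced_rng.2 (hf x y)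

theorem tendsto_weakStar {α : Type*} {l : Filter α} {f : α → H →L[ℂ] H} {A : H →L[ℂ] H}
    (hf : ∀ x y : lp (fun _ : ℕ => H) 2,
      Filter.Tendsto (fun a => normalFunctional x y (f a)) l (𝓝 (normalFunctional x y A))) :
    Filter.Tendsto f l (@nhds _ (weakStar H) A) := by
  simp only [nhds_iInf, Filter.tendsto_iInf, nhds_induced, Filter.tendsto_comap_iff]
  exact hf

theorem normalFunctional_single (x y : H) (A : H →L[ℂ] H) :
    normalFunctional (lp.single 2 0 x) (lp.single 2 0 y) A = inner ℂ y (A x) := by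
  rw [normalFunctional, tsum_eq_single 0]
  · simp
  · intro n hn
    simp [lp.single_apply, hn]

theorem continuous_inner_weakStar (x y : H) :
    Continuous[weakStar H, inferInstance] fun A : H →L[ℂ] H => inner ℂ y (A x) := by
  simpa only [← normalFunctional_single] using
    continuous_normalFunctional (lp.single 2 0 x) (lp.single 2 0 y)

/-- Pulling a normal functional back along a slice map or a Cesàro map gives a doubly indexed
series; a pairing of `ℕ × ℕ` with `ℕ` shows that it is again a normal functional. -/
theorem continuous_tsum_inner_weakStar {x y : ℕ × ℕ → H} (hx : Summable fun i => ‖x i‖ ^ 2)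
    (hy : Summable fun i => ‖y i‖ ^ 2) :
    Continuous[weakStar H, inferInstance] fun A : H →L[ℂ] H => ∑' i, inner ℂ (y i) (A (x i)) := by
  have hx' := Nat.pairEquiv.symm.summable_iff.2 hx
  have hy' := Nat.pairEquiv.symm.summable_iff.2 hy
  have h : (fun A : H →L[ℂ] H => ∑' i, inner ℂ (y i) (A (x i))) =
      normalFunctional (l2Mk _ hx') (l2Mk _ hy') := by
    ext A
    exact (Nat.pairEquiv.symm.tsum_eq fun i => inner ℂ (y i) (A (x i))).symm
  rw [h]
  exact continuous_normalFunctional _ _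

/-- The bound is additive in the squared norms, so it can be summed over windows, whose squared
norms have a known total. -/
theorem norm_inner_apply_le (A : H →L[ℂ] H) (x y : H) :
    ‖inner ℂ y (A x)‖ ≤ ‖A‖ * ((‖x‖ ^ 2 + ‖y‖ ^ 2) / 2) := by
  have h1 := norm_inner_le_norm (𝕜 := ℂ) y (A x)
  have h3 : ‖y‖ * ‖A x‖ ≤ ‖y‖ * (‖A‖ * ‖x‖) := by gcongr; exact A.le_opNorm x
  nlinarith [mul_nonneg (norm_nonneg A) (sq_nonneg (‖x‖ - ‖y‖))]

theorem summable_inner_apply {ι : Type*} {x y : ι → H} (hx : Summable fun i => ‖x i‖ ^ 2)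
    (hy : Summable fun i => ‖y i‖ ^ 2) (A : H →L[ℂ] H) :
    Summable fun i => inner ℂ (y i) (A (x i)) :=
  .of_norm_bounded (((hx.add hy).div_const 2).mul_left ‖A‖) fun _ => norm_inner_apply_le A _ _

/-- A quadratic bound on the sesquilinear form of `A` bounds the operator norm. -/
theorem opNorm_le_of_forall_inner {A : H →L[ℂ] H} {C : ℝ} (hC : 0 ≤ C)
    (h : ∀ x y, ‖inner ℂ y (A x)‖ ≤ C * ((‖x‖ ^ 2 + ‖y‖ ^ 2) / 2)) : ‖A‖ ≤ C := by
  refine A.opNorm_le_of_unit_norm hC fun x hx => ?_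
  rcases eq_or_ne (A x) 0 with h0 | h0
  · simpa [h0] using hC
  have hn : ‖A x‖ ≠ 0 := norm_ne_zero_iff.2 h0
  -- For a unit vector `x` the normalised vector `A x / ‖A x‖` pairs with `A x` to give `‖A x‖`, and
  -- the quadratic bound becomes `C`.
  have := h x ((‖A x‖⁻¹ : ℂ) • A x)
  rw [inner_smul_left, inner_self_eq_norm_sq_to_K, norm_smul] at this
  have e : (starRingEnd ℂ) ((‖A x‖ : ℂ)⁻¹) * ((‖A x‖ : ℂ) ^ 2) = (‖A x‖ : ℂ) := by
    have : (‖A x‖ : ℂ) ≠ 0 := by exact_mod_cast hn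
    simp; field_simp
  simp only [Complex.coe_algebraMap] at this
  rw [e] at this
  simpa [hx, hn] using this

end WeakStar

/-! ### Graded Hilbert spaces and windows of degrees -/

section Grading

variable {H : Type*} [NormedAddCommGroup H] [InnerProductSpace ℂ H]

/-- `E` is the family of spectral projections of a grading of `H` by `ℕ`. -/
structure IsGrading (E : ℕ → H →L[ℂ] H) : Prop where
  symm : ∀ n x y, inner ℂ (E n x) y = inner ℂ x (E n y)
  idem : ∀ n x, E n (E n x) = E n x
  orth : ∀ m n x, m ≠ n → E m (E n x) = 0
  total : ∀ x, (∀ n, E n x = 0) → x = 0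

/-- The degrees in the half-open window `(s - k, s]`. -/
def degreeWindow (k s : ℕ) : Finset ℕ := Finset.Ico (s + 1 - k) (s + 1)

/-- Seen from a fixed degree `n`, exactly `k` windows contain it. Truncated subtraction cuts the
first windows off at degree `0`, so this count holds for small `n` too. -/
theorem mem_degreeWindow {k s n : ℕ} : n ∈ degreeWindow k s ↔ s ∈ Finset.Ico n (n + k) := by
  simp only [degreeWindow, Finset.mem_Ico]; omega

theorem sum_degreeWindow (k s : ℕ) (g : ℕ → ℝ) :
    ∑ n ∈ degreeWindow k s, g n = ∑ r ∈ Finset.range k, if r ≤ s then g (s - r) else 0 := by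
  induction k with
  | zero => simp [degreeWindow]
  | succ k ih =>
    rw [Finset.sum_range_succ, ← ih]
    unfold degreeWindow
    split_ifs with h
    · rw [Finset.sum_eq_sum_Ico_succ_bot (by omega), add_comm,
        show s + 1 - (k + 1) + 1 = s + 1 - k by omega, show s + 1 - (k + 1) = s - k by omega]
    · rw [show s + 1 - (k + 1) = s + 1 - k by omega, add_zero]

/-- Summing over windows amounts to summing `k` shifted copies of `g`. -/
theorem hasSum_sum_degreeWindow {g : ℕ → ℝ} {a : ℝ} (hg : HasSum g a) (k : ℕ) :
    HasSum (fun s => ∑ n ∈ degreeWindow k s, g n) (k * a) := by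
  simp only [sum_degreeWindow]
  suffices h : ∀ r ∈ Finset.range k, HasSum (fun s => if r ≤ s then g (s - r) else 0) a by
    simpa using hasSum_sum h
  · refine fun r _ => ((add_left_injective r).hasSum_iff (f := fun s => if r ≤ s then g (s - r) else 0)
      fun s hs => ?_).1 ?_
    · rw [if_neg]
      intro h
      exact hs ⟨s - r, Nat.sub_add_cancel h⟩
    · simpa [Function.comp_def] using hg

/-- The projection onto the degrees in `degreeWindow k s`. -/
def windowProj (E : ℕ → H →L[ℂ] H) (k s : ℕ) : H →L[ℂ] H := ∑ n ∈ degreeWindow k s, E n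

theorem windowProj_apply (E : ℕ → H →L[ℂ] H) (k s : ℕ) (x : H) :
    windowProj E k s x = ∑ n ∈ degreeWindow k s, E n x := by
  simp [windowProj]

theorem windowProj_of_lt (E : ℕ → H →L[ℂ] H) {k s : ℕ} (h : s < k) (x : H) :
    windowProj E k s x = ∑ n ∈ Finset.range (s + 1), E n x := by
  rw [windowProj_apply, degreeWindow, Nat.sub_eq_zero_of_le h, Finset.range_eq_Ico]

namespace IsGrading

variable {E : ℕ → H →L[ℂ] H} (hE : IsGrading E)
include hE

theorem orthogonalFamily :
    OrthogonalFamily ℂ (fun n => LinearMap.range (E n).toLinearMap)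
      fun n => (LinearMap.range (E n).toLinearMap).subtypeₗᵢ := by
  rintro m n hmn ⟨_, x, rfl⟩ ⟨_, y, rfl⟩
  simpa [hE.orth m n y hmn] using hE.symm m x (E n y)

theorem norm_sum_sq (S : Finset ℕ) (x : H) : ‖∑ n ∈ S, E n x‖ ^ 2 = ∑ n ∈ S, ‖E n x‖ ^ 2 :=
  hE.orthogonalFamily.norm_sum (fun n => ⟨E n x, x, rfl⟩) S

theorem apply_sum (m : ℕ) (S : Finset ℕ) (x : H) :
    E m (∑ n ∈ S, E n x) = if m ∈ S then E m x else 0 := by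
  rw [map_sum, Finset.sum_congr rfl fun n _ => show E m (E n x) = if m = n then E m x else 0 by
    split_ifs with h
    · rw [← h, hE.idem]
    · exact hE.orth m n x h]
  simp

theorem sum_apply (m : ℕ) (S : Finset ℕ) (x : H) :
    ∑ n ∈ S, E n (E m x) = if m ∈ S then E m x else 0 := by
  rw [Finset.sum_congr rfl fun n _ => show E n (E m x) = if m = n then E m x else 0 by
    split_ifs with h
    · rw [← h, hE.idem]
    · exact hE.orth n m x (Ne.symm h)]
  simp

theorem norm_sum_le (S : Finset ℕ) (x : H) : ‖∑ n ∈ S, E n x‖ ≤ ‖x‖ := by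
  have h : ‖∑ n ∈ S, E n x‖ ^ 2 ≤ ‖x‖ * ‖∑ n ∈ S, E n x‖ := by
    have h1 : (inner ℂ (∑ n ∈ S, E n x) (∑ n ∈ S, E n x) : ℂ) = inner ℂ x (∑ n ∈ S, E n x) := by
      rw [sum_inner, inner_sum]
      refine Finset.sum_congr rfl fun n hn => ?_
      rw [hE.symm, hE.apply_sum, if_pos hn]
    rw [← inner_self_eq_norm_sq (𝕜 := ℂ), h1]
    exact (RCLike.re_le_norm _).trans (norm_inner_le_norm _ _)
  rcases (norm_nonneg (∑ n ∈ S, E n x)).eq_or_lt with h0 | h0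
  · rw [← h0]; positivity
  · exact le_of_mul_le_mul_right (by linarith [sq ‖∑ n ∈ S, E n x‖]) h0

variable [CompleteSpace H]

/-- Bessel's inequality makes the orthogonal series summable; the difference between `x` and its sum
is killed by every `E m`, hence vanishes by totality. -/
theorem hasSum (x : H) : HasSum (fun n => E n x) x := by
  have hs : Summable fun n => ‖E n x‖ ^ 2 :=
    summable_of_sum_le (c := ‖x‖ ^ 2) (fun n => by positivity) fun S => by
      rw [← hE.norm_sum_sq]
      exact pow_le_pow_left₀ (norm_nonneg _) (hE.norm_sum_le S x) 2
  obtain ⟨z, hz⟩ : Summable fun n => E n x :=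
    (hE.orthogonalFamily.summable_iff_norm_sq_summable fun n => ⟨E n x, x, rfl⟩).2 hs
  have : x - z = 0 := hE.total _ fun m => by
    rw [map_sub, sub_eq_zero]
    refine HasSum.unique ?_ ((E m).hasSum hz)
    have h : (fun n => E m (E n x)) = fun n => if n = m then E m x else 0 := by
      ext n
      split_ifs with h
      · rw [h, hE.idem]
      · exact hE.orth m n x (Ne.symm h)
    rw [h]
    exact hasSum_ite_eq m _
  rwa [← sub_eq_zero.1 this] at hz

theorem hasSum_norm_sq (x : H) : HasSum (fun n => ‖E n x‖ ^ 2) (‖x‖ ^ 2) := by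
  have := ((hE.hasSum x).norm.pow 2)
  simpa only [HasSum, hE.norm_sum_sq] using this

theorem hasSum_windowProj (k : ℕ) (x : H) :
    HasSum (fun s => ‖windowProj E k s x‖ ^ 2) (k * ‖x‖ ^ 2) := by
  simpa only [windowProj_apply, hE.norm_sum_sq] using
    hasSum_sum_degreeWindow (hE.hasSum_norm_sq x) k

theorem ext_inner {A B : H →L[ℂ] H}
    (h : ∀ i j x y, inner ℂ (E i y) (A (E j x)) = (inner ℂ (E i y) (B (E j x)) : ℂ)) : A = B := by
  have h1 : ∀ j x, A (E j x) = B (E j x) := fun j x => by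
    refine sub_eq_zero.1 (hE.total _ fun i => ?_)
    refine ext_inner_left ℂ fun y => ?_
    rw [inner_zero_right, ← hE.symm, inner_sub_right, h, sub_self]
  ext x
  refine (A.hasSum (hE.hasSum x)).unique ?_
  simpa only [h1] using B.hasSum (hE.hasSum x)

end IsGrading

end Grading

/-! ### Cesàro maps on the operators of a graded Hilbert space -/

section Cesaro

variable {H : Type*} [NormedAddCommGroup H] [InnerProductSpace ℂ H]

/-- The operator that applies `A` to each entry of a square-summable sequence. -/
def diagonalOp (A : H →L[ℂ] H) : lp (fun _ : ℕ => H) 2 →L[ℂ] lp (fun _ : ℕ => H) 2 :=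
  have hs (x : lp (fun _ : ℕ => H) 2) : ∀ n, ‖A (x n)‖ ^ 2 ≤ ‖A‖ ^ 2 * ‖x n‖ ^ 2 := fun n => by
    rw [← mul_pow]
    exact pow_le_pow_left₀ (norm_nonneg _) (A.le_opNorm _) 2
  have hm (x : lp (fun _ : ℕ => H) 2) : Summable fun n => ‖A (x n)‖ ^ 2 :=
    .of_nonneg_of_le (fun n => by positivity) (hs x) ((summable_norm_sq x).mul_left _)
  LinearMap.mkContinuous
    { toFun := fun x => l2Mk (fun n => A (x n)) (hm x)
      map_add' := fun x y => by ext n; simp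
      map_smul' := fun c x => by ext n; simp } ‖A‖ fun x => by
    refine le_of_sq_le_sq ?_ (by positivity)
    rw [norm_sq_eq_tsum, mul_pow, norm_sq_eq_tsum, ← tsum_mul_left]
    exact (hm x).tsum_le_tsum (hs x) ((summable_norm_sq x).mul_left _)

@[simp]
theorem diagonalOp_apply (A : H →L[ℂ] H) (x : lp (fun _ : ℕ => H) 2) (n : ℕ) :
    diagonalOp A x n = A (x n) :=
  rfl

variable [CompleteSpace H] {E : ℕ → H →L[ℂ] H}

namespace IsGrading

variable (hE : IsGrading E)

/-- The map `x ↦ (Q_s x)_s`, where `Q_s` is the projection onto the `s`-th window of length `k`. -/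
def windowSeq (k : ℕ) : H →L[ℂ] lp (fun _ : ℕ => H) 2 :=
  LinearMap.mkContinuous
    { toFun := fun x => l2Mk (fun s => windowProj E k s x) (hE.hasSum_windowProj k x).summable
      map_add' := fun x y => by ext n; simp
      map_smul' := fun c x => by ext n; simp } √k fun x => by
    refine le_of_sq_le_sq ?_ (by positivity)
    rw [norm_sq_eq_tsum, mul_pow, Real.sq_sqrt (by positivity)]
    exact (hE.hasSum_windowProj k x).tsum_eq.le

@[simp]
theorem windowSeq_apply (k s : ℕ) (x : H) : hE.windowSeq k x s = windowProj E k s x :=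
  rfl

/-- The Cesàro (Fejér) map on `B(H)` of a graded Hilbert space: the block in position `(i, j)` is
multiplied by `max (1 - |i - j| / k) 0`. It is the average of the compressions to the windows of
length `k`. -/
def cesaro (k : ℕ) : (H →L[ℂ] H) →ₗ[ℂ] (H →L[ℂ] H) where
  toFun A := (k : ℂ)⁻¹ • ((hE.windowSeq k).adjoint ∘L diagonalOp A ∘L hE.windowSeq k)
  map_add' A B := by
    rw [← smul_add]
    congr 1
    ext x
    simp only [ContinuousLinearMap.comp_apply, add_apply]
    rw [← map_add]
    congr 1
  map_smul' c A := by
    rw [RingHom.id_apply, smul_comm]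
    congr 1
    ext x
    simp only [ContinuousLinearMap.comp_apply, smul_apply]
    rw [← map_smul]
    congr 1

include hE in
theorem summable_inner_window (k : ℕ) (A : H →L[ℂ] H) (x y : H) :
    Summable fun s => (inner ℂ (windowProj E k s y) (A (windowProj E k s x)) : ℂ) :=
  summable_inner_apply (hE.hasSum_windowProj k x).summable (hE.hasSum_windowProj k y).summable A

/-- The working form of the definition: contractivity, normality, convergence and the block
multiplier are all read off from this average over windows. -/
theorem inner_cesaro (k : ℕ) (A : H →L[ℂ] H) (x y : H) :
    inner ℂ y (hE.cesaro k A x) =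
      (k : ℂ)⁻¹ * ∑' s, inner ℂ (windowProj E k s y) (A (windowProj E k s x)) := by
  simp [cesaro, ContinuousLinearMap.adjoint_inner_right, lp.inner_eq_tsum]

include hE in
/-- The windows of length `k` have average square norm `‖x‖²`. -/
theorem hasSum_windowProj_bound (k : ℕ) (C : ℝ) (x y : H) :
    HasSum (fun s => C * ((‖windowProj E k s x‖ ^ 2 + ‖windowProj E k s y‖ ^ 2) / 2))
      (k * (C * ((‖x‖ ^ 2 + ‖y‖ ^ 2) / 2))) := by
  have h := (((hE.hasSum_windowProj k x).add (hE.hasSum_windowProj k y)).div_const 2).mul_left C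
  rwa [show C * ((k * ‖x‖ ^ 2 + k * ‖y‖ ^ 2) / 2) = k * (C * ((‖x‖ ^ 2 + ‖y‖ ^ 2) / 2)) by ring]
    at h

theorem norm_cesaro_le (k : ℕ) (A : H →L[ℂ] H) : ‖hE.cesaro k A‖ ≤ ‖A‖ := by
  refine opNorm_le_of_forall_inner (norm_nonneg _) fun x y => ?_
  rw [inner_cesaro, norm_mul, norm_inv, Complex.norm_natCast]
  have h := tsum_of_norm_bounded (hE.hasSum_windowProj_bound k ‖A‖ x y)
    fun s => norm_inner_apply_le A _ _
  rcases k.eq_zero_or_pos with rfl | hk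
  · simp; positivity
  · rwa [inv_mul_le_iff₀ (by positivity)]

/-- The pulled-back functional is given by the vectors `Q_s x_n` and `Q_s y_n`, which are
square-summable over `(n, s)` because `∑_s ‖Q_s x_n‖² = k ‖x_n‖²`. -/
theorem continuous_cesaro (k : ℕ) : Continuous[weakStar H, weakStar H] (hE.cesaro k) := by
  refine @continuous_weakStar_rng _ _ _ _ (weakStar H) _ fun x y => ?_
  have hs (x : lp (fun _ : ℕ => H) 2) :
      Summable fun i : ℕ × ℕ => ‖windowProj E k i.2 (x i.1)‖ ^ 2 := by
    refine (summable_prod_of_nonneg fun i => by positivity).2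
      ⟨fun n => (hE.hasSum_windowProj k (x n)).summable, ?_⟩
    simp only [(hE.hasSum_windowProj k _).tsum_eq]
    exact (summable_norm_sq x).mul_left _
  have h : (fun A => normalFunctional x y (hE.cesaro k A)) = fun A => (k : ℂ)⁻¹ * ∑' i : ℕ × ℕ,
      inner ℂ (windowProj E k i.2 (y i.1)) (A (windowProj E k i.2 (x i.1))) := by
    ext A
    rw [(summable_inner_apply (hs x) (hs y) A).tsum_prod, normalFunctional, ← tsum_mul_left]
    simp only [inner_cesaro]
  rw [h]
  exact @Continuous.comp _ _ _ (weakStar H) _ _ _ _ (continuous_const_mul _)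
    (continuous_tsum_inner_weakStar (hs x) (hs y))

include hE in
theorem tendsto_partialSum (x : H) :
    Filter.Tendsto (fun s => ∑ n ∈ Finset.range (s + 1), E n x) Filter.atTop (𝓝 x) :=
  (hE.hasSum x).tendsto_sum_nat.comp (Filter.tendsto_add_atTop_nat 1)

include hE in
-- The squared window norms total `k ‖x‖²`. The first `k` windows are partial sums of `x`, so their
-- average squared norm tends to `‖x‖²` and leaves nothing for the tail.
theorem tendsto_window_tail (x : H) :
    Filter.Tendsto (fun k : ℕ => (k : ℝ)⁻¹ * ∑' s, ‖windowProj E k (s + k) x‖ ^ 2)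
      Filter.atTop (𝓝 0) := by
  have h1 := ((hE.tendsto_partialSum x).norm.pow 2).cesaro
  have h2 := h1.const_sub (‖x‖ ^ 2)
  rw [sub_self] at h2
  refine h2.congr' ?_
  filter_upwards [Filter.eventually_ge_atTop 1] with k hk
  have hk' : (k : ℝ) ≠ 0 := by positivity
  have h3 := (hE.hasSum_windowProj k x).summable.sum_add_tsum_nat_add k
  rw [(hE.hasSum_windowProj k x).tsum_eq] at h3
  rw [← sub_eq_of_eq_add' h3.symm, mul_sub, inv_mul_cancel_left₀ hk']
  congr 2
  exact Finset.sum_congr rfl fun s hs => by rw [windowProj_of_lt E (Finset.mem_range.1 hs)]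

theorem tendsto_inner_cesaro (A : H →L[ℂ] H) (x y : H) :
    Filter.Tendsto (fun k => (inner ℂ y (hE.cesaro k A x) : ℂ)) Filter.atTop
      (𝓝 (inner ℂ y (A x))) := by
  -- The windows with `s < k` are initial partial sums, so their terms are independent of `k` and
  -- converge; their averages have the same limit.
  have h1 := ((hE.tendsto_partialSum y).inner (𝕜 := ℂ)
    ((A.continuous.tendsto x).comp (hE.tendsto_partialSum x))).cesaro_smul
  -- The windows with `s ≥ k` are controlled by the tail averages of `x` and `y`.
  have h2 : Filter.Tendsto
      (fun k : ℕ => (k : ℂ)⁻¹ * ∑' s, (inner ℂ (windowProj E k (s + k) y)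
        (A (windowProj E k (s + k) x)) : ℂ)) Filter.atTop (𝓝 0) := by
    have h3 := (((hE.tendsto_window_tail x).add (hE.tendsto_window_tail y)).div_const 2).const_mul
      ‖A‖
    rw [add_zero, zero_div, mul_zero] at h3
    refine squeeze_zero_norm (fun k => ?_) h3
    rw [norm_mul, norm_inv, Complex.norm_natCast]
    have hx := (summable_nat_add_iff k).2 (hE.hasSum_windowProj k x).summable
    have hy := (summable_nat_add_iff k).2 (hE.hasSum_windowProj k y).summable
    have h4 := tsum_of_norm_bounded (((hx.hasSum.add hy.hasSum).div_const 2).mul_left ‖A‖)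
      fun s => norm_inner_apply_le A (windowProj E k (s + k) x) (windowProj E k (s + k) y)
    refine (mul_le_mul_of_nonneg_left h4 (by positivity)).trans_eq ?_
    ring
  have h5 := h1.add h2
  rw [add_zero] at h5
  refine h5.congr fun k => ?_
  rw [inner_cesaro, ← (hE.summable_inner_window k A x y).sum_add_tsum_nat_add k, mul_add]
  congr 1
  rw [Complex.real_smul]
  push_cast
  congr 1
  exact Finset.sum_congr rfl fun s hs => by
    simp only [windowProj_of_lt E (Finset.mem_range.1 hs), Function.comp_apply]

theorem tendsto_cesaro (A : H →L[ℂ] H) :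
    Filter.Tendsto (fun k => hE.cesaro k A) Filter.atTop (@nhds _ (weakStar H) A) := by
  refine tendsto_weakStar fun x y => ?_
  refine tendsto_tsum_of_dominated_convergence
    (((summable_norm_sq x).add (summable_norm_sq y)).div_const 2 |>.mul_left ‖A‖)
    (fun n => hE.tendsto_inner_cesaro A _ _) (.of_forall fun k n => ?_)
  refine (norm_inner_apply_le _ _ _).trans ?_
  gcongr
  exact hE.norm_cesaro_le k A

/-- The window at `s` leaves the block `(i, j)` unchanged if it contains both degrees and kills it
otherwise, so the multiplier counts the common windows. -/
theorem inner_cesaro_homogeneous (k i j : ℕ) (A : H →L[ℂ] H) (x y : H) :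
    inner ℂ (E i y) (hE.cesaro k A (E j x)) =
      (k : ℂ)⁻¹ * (Finset.Ico i (i + k) ∩ Finset.Ico j (j + k)).card *
        inner ℂ (E i y) (A (E j x)) := by
  have hw (s m : ℕ) (z : H) :
      windowProj E k s (E m z) = if s ∈ Finset.Ico m (m + k) then E m z else 0 := by
    simp only [windowProj_apply, hE.sum_apply, mem_degreeWindow]
  rw [inner_cesaro, mul_assoc, ← nsmul_eq_mul, ← Finset.sum_const,
    tsum_eq_sum (s := Finset.Ico i (i + k) ∩ Finset.Ico j (j + k))]
  · refine congrArg _ (Finset.sum_congr rfl fun s hs => ?_)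
    rw [Finset.mem_inter] at hs
    rw [hw, hw, if_pos hs.1, if_pos hs.2]
  · intro s hs
    rw [Finset.mem_inter, not_and_or] at hs
    rw [hw, hw]
    rcases hs with h | h <;> simp only [if_neg h, inner_zero_left, map_zero, inner_zero_right]

/-- The Cesàro maps are completely contractive. -/
theorem norm_matrixOperator_cesaro_le (k : ℕ) {n : ℕ} (A : Matrix (Fin n) (Fin n) (H →L[ℂ] H)) :
    ‖matrixOperator fun i j => hE.cesaro k (A i j)‖ ≤ ‖matrixOperator A‖ := by
  refine opNorm_le_of_forall_inner (norm_nonneg _) fun x y => ?_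
  let Q (s : ℕ) (x : PiLp 2 fun _ : Fin n => H) : PiLp 2 fun _ : Fin n => H :=
    WithLp.toLp 2 fun i => windowProj E k s (x i)
  have hQ (x : PiLp 2 fun _ : Fin n => H) : HasSum (fun s => ‖Q s x‖ ^ 2) (k * ‖x‖ ^ 2) := by
    simp only [PiLp.norm_sq_eq_of_L2, Finset.mul_sum]
    exact hasSum_sum fun i _ => hE.hasSum_windowProj k (x i)
  have hb := ((((hQ x).add (hQ y)).div_const 2).mul_left ‖matrixOperator A‖)
  -- The amplified map is the same average, with `Q_s` acting on every coordinate; the scalar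
  -- argument then applies unchanged.
  have key : inner ℂ y (matrixOperator (fun i j => hE.cesaro k (A i j)) x) =
      (k : ℂ)⁻¹ * ∑' s, inner ℂ (Q s y) (matrixOperator A (Q s x)) := by
    have hm (i : Fin n) : matrixOperator (fun i j => hE.cesaro k (A i j)) x i =
        ∑ j, hE.cesaro k (A i j) (x j) := matrixOperator_apply _ x i
    simp only [PiLp.inner_apply, hm, matrixOperator_apply, inner_sum, inner_cesaro, Q]
    refine Eq.trans ?_ (congrArg _ (hasSum_sum fun i _ => hasSum_sum fun j _ =>
      (hE.summable_inner_window k (A i j) (x j) (y i)).hasSum).tsum_eq.symm)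
    simp only [Finset.mul_sum]
  rw [key, norm_mul, norm_inv, Complex.norm_natCast]
  have h := tsum_of_norm_bounded hb fun s => norm_inner_apply_le (matrixOperator A) (Q s x) (Q s y)
  rcases k.eq_zero_or_pos with rfl | hk
  · simp; positivity
  · rw [inv_mul_le_iff₀ (by positivity)]
    refine h.trans_eq ?_
    ring

end IsGrading

end Cesaro

/-! ### The Fock space grading and the commutant of the right shifts -/

section Fock

variable {d : ℕ}

theorem inner_fockBasis (w : FreeMonoid (Fin d)) (x : FockSpace d) :
    inner ℂ (fockBasis w) x = x w := by
  classical
  simp [fockBasis, lp.inner_single_left]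

theorem fockBasis_apply [DecidableEq (FreeMonoid (Fin d))] (u w : FreeMonoid (Fin d)) :
    (fockBasis u : FockSpace d) w = if w = u then 1 else 0 := by
  classical
  simp [fockBasis, lp.single_apply, Pi.single_apply]

theorem fockSpace_clm_ext {F : Type*} [NormedAddCommGroup F] [NormedSpace ℂ F]
    {A B : FockSpace d →L[ℂ] F} (h : ∀ w, A (fockBasis w) = B (fockBasis w)) : A = B := by
  classical
  refine lp.ext_continuousLinearMap (by norm_num) fun w => ?_
  ext
  simpa [fockBasis] using h w

/-- The word of length `n` with the given letters. -/
def wordOfFn {n : ℕ} (v : Fin n → Fin d) : FreeMonoid (Fin d) := FreeMonoid.ofList (List.ofFn v)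

theorem length_wordOfFn {n : ℕ} (v : Fin n → Fin d) : (wordOfFn v).length = n :=
  List.length_ofFn

theorem wordOfFn_injective {n : ℕ} :
    Function.Injective (wordOfFn : (Fin n → Fin d) → FreeMonoid (Fin d)) := fun _ _ h =>
  List.ofFn_injective (FreeMonoid.ofList.injective h)

theorem exists_wordOfFn_eq {n : ℕ} {w : FreeMonoid (Fin d)} (h : w.length = n) :
    ∃ v : Fin n → Fin d, wordOfFn v = w := by
  subst h
  exact ⟨w.toList.get, congrArg FreeMonoid.ofList (List.ofFn_get w.toList)⟩

/-- The projection of the Fock space onto the span of the `ξ_w` with `|w| = n`. -/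
def degreeProj (d n : ℕ) : FockSpace d →L[ℂ] FockSpace d :=
  ∑ v : Fin n → Fin d, (innerSL ℂ (fockBasis (wordOfFn v))).smulRight (fockBasis (wordOfFn v))

theorem degreeProj_apply (n : ℕ) (x : FockSpace d) :
    degreeProj d n x = ∑ v : Fin n → Fin d, x (wordOfFn v) • fockBasis (wordOfFn v) := by
  simp [degreeProj, inner_fockBasis]

theorem degreeProj_coord (n : ℕ) (x : FockSpace d) (w : FreeMonoid (Fin d)) :
    degreeProj d n x w = if w.length = n then x w else 0 := by
  classical
  rw [degreeProj_apply, ← inner_fockBasis, inner_sum]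
  simp only [inner_smul_right, inner_fockBasis, fockBasis_apply]
  split_ifs with h
  · obtain ⟨v, rfl⟩ := exists_wordOfFn_eq h
    simp [wordOfFn_injective.eq_iff]
  · refine Finset.sum_eq_zero fun v _ => ?_
    rw [if_neg, mul_zero]
    rintro rfl
    exact h (length_wordOfFn v)

theorem degreeProj_fockBasis (n : ℕ) (w : FreeMonoid (Fin d)) :
    degreeProj d n (fockBasis w) = if w.length = n then fockBasis w else 0 := by
  classical
  ext u
  rw [degreeProj_coord, fockBasis_apply]
  by_cases hu : u = w
  · subst hu
    rw [if_pos rfl]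
    split_ifs
    · rw [fockBasis_apply, if_pos rfl]
    · rfl
  · rw [if_neg hu, ite_self]
    split_ifs
    · rw [fockBasis_apply, if_neg hu]
    · rfl

theorem isGrading_degreeProj (d : ℕ) : IsGrading (degreeProj d) where
  symm n x y := by
    rw [lp.inner_eq_tsum, lp.inner_eq_tsum]
    refine tsum_congr fun w => ?_
    rw [degreeProj_coord, degreeProj_coord]
    split_ifs <;> simp
  idem n x := by
    ext w
    simp only [degreeProj_coord]
    split_ifs <;> rfl
  orth m n x hmn := by
    ext w
    simp only [degreeProj_coord]
    split_ifs with h1 h2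
    · exact absurd (h1.symm.trans h2) hmn
    · rfl
    · rfl
  total x hx := by
    ext w
    have := degreeProj_coord w.length x w
    rw [hx, if_pos rfl] at this
    exact this.symm

theorem orthonormal_fockBasis_mul_right (u : FreeMonoid (Fin d)) :
    Orthonormal ℂ fun w => fockBasis (w * u) := by
  classical
  rw [orthonormal_iff_ite]
  intro i j
  simp [inner_fockBasis, fockBasis_apply]

/-- The right regular representation: `R_u ξ_w = ξ_{wu}`. -/
def rightRegular (u : FreeMonoid (Fin d)) : FockSpace d →L[ℂ] FockSpace d :=
  (orthonormal_fockBasis_mul_right u).orthogonalFamily.linearIsometry.toContinuousLinearMap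

theorem rightRegular_fockBasis (u w : FreeMonoid (Fin d)) :
    rightRegular u (fockBasis w) = fockBasis (w * u) := by
  simp [rightRegular, fockBasis]

theorem rightRegular_leftRegular (u v : FreeMonoid (Fin d)) (x : FockSpace d) :
    rightRegular u (leftRegular v x) = leftRegular v (rightRegular u x) := by
  suffices h : rightRegular u ∘L leftRegular v = leftRegular v ∘L rightRegular u from
    DFunLike.congr_fun h x
  refine fockSpace_clm_ext fun w => ?_
  simp [leftRegular_fockBasis, rightRegular_fockBasis, mul_assoc]

theorem degreeProj_rightRegular_add (u : FreeMonoid (Fin d)) (n : ℕ) (x : FockSpace d) :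
    degreeProj d (n + u.length) (rightRegular u x) = rightRegular u (degreeProj d n x) := by
  suffices h : degreeProj d (n + u.length) ∘L rightRegular u = rightRegular u ∘L degreeProj d n from
    DFunLike.congr_fun h x
  refine fockSpace_clm_ext fun w => ?_
  simp [degreeProj_fockBasis, rightRegular_fockBasis, FreeMonoid.length_mul,
    apply_ite (rightRegular u)]

theorem degreeProj_rightRegular_of_lt (u : FreeMonoid (Fin d)) {n : ℕ} (h : n < u.length)
    (x : FockSpace d) : degreeProj d n (rightRegular u x) = 0 := by
  suffices h : degreeProj d n ∘L rightRegular u = 0 from DFunLike.congr_fun h x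
  refine fockSpace_clm_ext fun w => ?_
  rw [ContinuousLinearMap.comp_apply, rightRegular_fockBasis, degreeProj_fockBasis,
    if_neg (by rw [FreeMonoid.length_mul]; omega)]
  rfl

/-- The commutant of the right regular representation. -/
def rightCommutant (d : ℕ) : Subalgebra ℂ (FockSpace d →L[ℂ] FockSpace d) :=
  Subalgebra.centralizer ℂ (Set.range rightRegular)

theorem mem_rightCommutant {A : FockSpace d →L[ℂ] FockSpace d} :
    A ∈ rightCommutant d ↔ ∀ u x, rightRegular u (A x) = A (rightRegular u x) := by
  simp only [rightCommutant, Subalgebra.mem_centralizer_iff, Set.forall_mem_range,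
    ContinuousLinearMap.ext_iff]
  rfl

theorem leftRegular_mem_rightCommutant (u : FreeMonoid (Fin d)) :
    leftRegular u ∈ rightCommutant d :=
  mem_rightCommutant.2 fun v x => rightRegular_leftRegular v u x

/-- An element of the commutant is determined by its value at the vacuum vector;
`rightCommutant_ext` rests on this. -/
theorem apply_fockBasis_of_mem {A : FockSpace d →L[ℂ] FockSpace d} (hA : A ∈ rightCommutant d)
    (w : FreeMonoid (Fin d)) : A (fockBasis w) = rightRegular w (A (fockBasis 1)) := by
  rw [mem_rightCommutant.1 hA, rightRegular_fockBasis, one_mul]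

theorem continuous_inner_wot {H : Type*} [NormedAddCommGroup H] [InnerProductSpace ℂ H]
    [CompleteSpace H] (x y : H) :
    Continuous fun A : H →WOT[ℂ] H => (inner ℂ y (A x) : ℂ) :=
  ContinuousLinearMapWOT.continuous_iff.1 continuous_id x y

theorem isWOTClosed_rightCommutant :
    IsWOTClosed (rightCommutant d : Set (FockSpace d →L[ℂ] FockSpace d)) := by
  have h : (ContinuousLinearMapWOT.toCLM ⁻¹' (rightCommutant d : Set _) :
      Set (FockSpace d →WOT[ℂ] FockSpace d)) =
      ⋂ (u) (x) (y), {A | inner ℂ ((rightRegular u).adjoint y) (A x) =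
        (inner ℂ y (A (rightRegular u x)) : ℂ)} := by
    ext A
    simp only [Set.mem_preimage, SetLike.mem_coe, mem_rightCommutant, Set.mem_iInter,
      Set.mem_ofPred_eq, ContinuousLinearMap.adjoint_inner_left]
    exact forall_congr' fun u => forall_congr' fun x =>
      ⟨fun h y => congrArg _ h, fun h => ext_inner_left ℂ h⟩
  unfold IsWOTClosed
  rw [h]
  refine isClosed_iInter fun u => isClosed_iInter fun x => isClosed_iInter fun y => ?_
  exact isClosed_eq (continuous_inner_wot _ _)
    (continuous_inner_wot _ _)

theorem freeSemigroupAlgebra_le_rightCommutant : freeSemigroupAlgebra d ≤ rightCommutant d :=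
  sInf_le ⟨isWOTClosed_rightCommutant, leftRegular_mem_rightCommutant⟩

theorem leftRegular_mem (u : FreeMonoid (Fin d)) : leftRegular u ∈ freeSemigroupAlgebra d :=
  Algebra.mem_sInf.2 fun _ h => h.2 u

/-- The homogeneous part of degree `n` of an element of `L_d`. -/
def homogeneousPart (n : ℕ) (A : FockSpace d →L[ℂ] FockSpace d) : FockSpace d →L[ℂ] FockSpace d :=
  ∑ v : Fin n → Fin d, wordCoeff A (wordOfFn v) • leftRegular (wordOfFn v)

theorem homogeneousPart_mem_of_forall (S : Submodule ℂ (FockSpace d →L[ℂ] FockSpace d))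
    (hS : ∀ u, leftRegular u ∈ S) (n : ℕ) (A : FockSpace d →L[ℂ] FockSpace d) :
    homogeneousPart n A ∈ S :=
  Submodule.sum_mem _ fun _ _ => Submodule.smul_mem _ _ (hS _)

theorem homogeneousPart_mem (n : ℕ) (A : FockSpace d →L[ℂ] FockSpace d) :
    homogeneousPart n A ∈ freeSemigroupAlgebra d :=
  homogeneousPart_mem_of_forall (freeSemigroupAlgebra d).toSubmodule leftRegular_mem n A

theorem homogeneousPart_fockBasis (n : ℕ) (A : FockSpace d →L[ℂ] FockSpace d)
    (w : FreeMonoid (Fin d)) :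
    homogeneousPart n A (fockBasis w) = rightRegular w (degreeProj d n (A (fockBasis 1))) := by
  simp [homogeneousPart, degreeProj_apply, wordCoeff, inner_fockBasis, leftRegular_fockBasis,
    rightRegular_fockBasis]

theorem homogeneousPart_fockBasis_one (n : ℕ) (A : FockSpace d →L[ℂ] FockSpace d) :
    homogeneousPart n A (fockBasis 1) = degreeProj d n (A (fockBasis 1)) := by
  have h : rightRegular (1 : FreeMonoid (Fin d)) = ContinuousLinearMap.id ℂ _ :=
    fockSpace_clm_ext fun w => by simp [rightRegular_fockBasis]
  rw [homogeneousPart_fockBasis, h, ContinuousLinearMap.id_apply]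

/-- Since `A ξ_w = R_w A ξ_∅` and `R_w` raises degrees by `|w|`, the matrix of `A` is lower
triangular, and its block in position `(i, j)` comes from the degree `i - j` part of `A ξ_∅`. -/
theorem degreeProj_apply_degreeProj {A : FockSpace d →L[ℂ] FockSpace d} (hA : A ∈ rightCommutant d)
    (i j : ℕ) (x : FockSpace d) :
    degreeProj d i (A (degreeProj d j x)) =
      if j ≤ i then homogeneousPart (i - j) A (degreeProj d j x) else 0 := by
  suffices h : degreeProj d i ∘L A ∘L degreeProj d j =
      if j ≤ i then homogeneousPart (i - j) A ∘L degreeProj d j else 0 by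
    have := DFunLike.congr_fun h x
    split_ifs at this ⊢ <;> exact this
  refine fockSpace_clm_ext fun w => ?_
  simp only [ContinuousLinearMap.comp_apply, degreeProj_fockBasis]
  by_cases hw : w.length = j
  · subst hw
    rw [if_pos rfl, apply_fockBasis_of_mem hA]
    split_ifs with h
    · obtain ⟨n, rfl⟩ := Nat.exists_eq_add_of_le' h
      rw [degreeProj_rightRegular_add, Nat.add_sub_cancel, ContinuousLinearMap.comp_apply,
        degreeProj_fockBasis, if_pos rfl, homogeneousPart_fockBasis]
    · exact degreeProj_rightRegular_of_lt w (not_le.1 h) _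
  · rw [if_neg hw, map_zero, map_zero]
    split_ifs with h
    · rw [ContinuousLinearMap.comp_apply, degreeProj_fockBasis, if_neg hw, map_zero]
    · rfl

theorem degreeProj_homogeneousPart (n i j : ℕ) (A : FockSpace d →L[ℂ] FockSpace d)
    (x : FockSpace d) :
    degreeProj d i (homogeneousPart n A (degreeProj d j x)) =
      if i = n + j then homogeneousPart n A (degreeProj d j x) else 0 := by
  suffices h : degreeProj d i ∘L homogeneousPart n A ∘L degreeProj d j =
      if i = n + j then homogeneousPart n A ∘L degreeProj d j else 0 by
    have := DFunLike.congr_fun h x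
    split_ifs at this ⊢ <;> exact this
  refine fockSpace_clm_ext fun w => ?_
  simp only [ContinuousLinearMap.comp_apply, degreeProj_fockBasis]
  by_cases hw : w.length = j
  · subst hw
    rw [if_pos rfl, homogeneousPart_fockBasis, ← degreeProj_rightRegular_add]
    split_ifs with h
    · rw [h, (isGrading_degreeProj d).idem, ContinuousLinearMap.comp_apply, degreeProj_fockBasis,
        if_pos rfl, homogeneousPart_fockBasis, degreeProj_rightRegular_add]
    · exact (isGrading_degreeProj d).orth _ _ _ h
  · rw [if_neg hw, map_zero, map_zero]
    split_ifs with h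
    · rw [ContinuousLinearMap.comp_apply, degreeProj_fockBasis, if_neg hw, map_zero]
    · rfl

theorem cesaroMap_eq_sum (k : ℕ) (A : FockSpace d →L[ℂ] FockSpace d) :
    cesaroMap k A = ∑ n ∈ Finset.range k, (1 - (n : ℂ) / (k : ℂ)) • homogeneousPart n A := by
  simp only [cesaroMap, homogeneousPart, Finset.smul_sum, smul_smul]
  rfl

theorem cesaroMap_mem (k : ℕ) (A : FockSpace d →L[ℂ] FockSpace d) :
    cesaroMap k A ∈ freeSemigroupAlgebra d := by
  rw [cesaroMap_eq_sum]
  exact sum_mem fun n _ => Subalgebra.smul_mem _ (homogeneousPart_mem n A) _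

theorem cesaro_eq_cesaroMap {A : FockSpace d →L[ℂ] FockSpace d} (hA : A ∈ rightCommutant d)
    (k : ℕ) : (isGrading_degreeProj d).cesaro k A = cesaroMap k A := by
  have hE := isGrading_degreeProj d
  refine hE.ext_inner fun i j x y => ?_
  rw [hE.inner_cesaro_homogeneous, cesaroMap_eq_sum, hE.symm, hE.symm,
    degreeProj_apply_degreeProj hA, sum_apply, map_sum]
  simp only [smul_apply, map_smul, degreeProj_homogeneousPart]
  rw [Finset.Ico_inter_Ico, Nat.card_Ico]
  split_ifs with h
  · obtain ⟨n, rfl⟩ := Nat.exists_eq_add_of_le' h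
    simp only [Nat.add_sub_cancel, add_left_inj]
    -- In block `(n + j, j)` the common windows number `k - n`, which after division by `k` is the
    -- Cesàro weight `1 - n/k`, or `0` when `n ≥ k`.
    rw [show min (n + j + k) (j + k) - max (n + j) j = k - n by omega]
    simp only [smul_ite, smul_zero, Finset.sum_ite_eq, Finset.mem_range]
    split_ifs with hn
    · have hk : (k : ℂ) ≠ 0 := by exact_mod_cast (show k ≠ 0 by omega)
      rw [inner_smul_right, Nat.cast_sub hn.le]
      congr 1
      field_simp
    · rw [Nat.sub_eq_zero_of_le (not_lt.1 hn)]
      simp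
  · rw [inner_zero_right, mul_zero, Finset.sum_eq_zero, inner_zero_right]
    intro n _
    rw [if_neg (by omega), smul_zero]

/-- The Cesàro polynomials of `A` lie in every algebra containing the `L_u` and converge to `A` in
the weak operator topology. -/
theorem rightCommutant_le_freeSemigroupAlgebra : rightCommutant d ≤ freeSemigroupAlgebra d := by
  intro A hA
  refine Algebra.mem_sInf.2 fun 𝒜 h𝒜 => ?_
  have ht : Filter.Tendsto (fun k => ContinuousLinearMapWOT.ofCLM (cesaroMap k A)) Filter.atTop
      (𝓝 (ContinuousLinearMapWOT.ofCLM A)) := by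
    rw [ContinuousLinearMapWOT.tendsto_iff_forall_inner_apply_tendsto]
    intro x y
    have h := (isGrading_degreeProj d).tendsto_inner_cesaro A x y
    simp only [cesaro_eq_cesaroMap hA] at h
    exact h
  refine h𝒜.1.mem_of_tendsto ht (.of_forall fun k => ?_)
  change cesaroMap k A ∈ 𝒜
  rw [cesaroMap_eq_sum]
  exact sum_mem fun n _ => Subalgebra.smul_mem _
    (homogeneousPart_mem_of_forall 𝒜.toSubmodule h𝒜.2 n A) _

end Fock

/-! ### Cesàro maps restricted to invariant subspaces -/

namespace IsGrading

variable {H : Type*} [NormedAddCommGroup H] [InnerProductSpace ℂ H] [CompleteSpace H]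
  {E : ℕ → H →L[ℂ] H} (hE : IsGrading E) {S : Submodule ℂ (H →L[ℂ] H)} {k : ℕ}
  (hS : ∀ A ∈ S, hE.cesaro k A ∈ S)

/-- The restriction of a Cesàro map to an invariant subspace. -/
def cesaroOn : S →ₗ[ℂ] S :=
  (hE.cesaro k).restrict hS

theorem isCompletelyContractive_cesaroOn : IsCompletelyContractive (hE.cesaroOn hS) :=
  fun _ A => hE.norm_matrixOperator_cesaro_le k fun i j => (A i j : H →L[ℂ] H)

theorem continuous_cesaroOn : Continuous[weakStarOn S, weakStarOn S] (hE.cesaroOn hS) := by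
  rw [continuous_iff_le_induced, weakStarOn, induced_compose]
  exact continuous_iff_le_induced.1 (@Continuous.comp _ _ _ (weakStarOn S) (weakStar H) (weakStar H)
    _ _ (hE.continuous_cesaro k) (@continuous_induced_dom _ _ Subtype.val (weakStar H)))

theorem isCCFiniteRankNormal_cesaroOn (W : Submodule ℂ (H →L[ℂ] H)) [FiniteDimensional ℂ W]
    (hW : ∀ A ∈ S, hE.cesaro k A ∈ W) : IsCCFiniteRankNormal (hE.cesaroOn hS) where
  completelyContractive := hE.isCompletelyContractive_cesaroOn hS
  weakStarContinuous := hE.continuous_cesaroOn hS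
  finiteRank := by
    have h : ∀ B : LinearMap.range (hE.cesaroOn hS), ((B : S) : H →L[ℂ] H) ∈ W := by
      rintro ⟨_, A, rfl⟩
      exact hW A A.2
    refine FiniteDimensional.of_injective
      ((S.subtype ∘ₗ (LinearMap.range (hE.cesaroOn hS)).subtype).codRestrict W h) fun B C hBC => ?_
    exact Subtype.ext (Subtype.ext (congrArg (fun A : W => (A : H →L[ℂ] H)) hBC))

end IsGrading

/-! ### Homogeneous parts of elements of a homogeneous ideal -/

section HomogeneousIdeal

variable {d : ℕ}

theorem rightCommutant_ext {A B : FockSpace d →L[ℂ] FockSpace d} (hA : A ∈ rightCommutant d)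
    (hB : B ∈ rightCommutant d) (h : A (fockBasis 1) = B (fockBasis 1)) : A = B :=
  fockSpace_clm_ext fun w => by rw [apply_fockBasis_of_mem hA, apply_fockBasis_of_mem hB, h]

theorem homogeneousPart_mem_rightCommutant (n : ℕ) (A : FockSpace d →L[ℂ] FockSpace d) :
    homogeneousPart n A ∈ rightCommutant d :=
  freeSemigroupAlgebra_le_rightCommutant (homogeneousPart_mem n A)

/-- `homogeneousPart` as a linear map. -/
def homogeneousPartₗ (d n : ℕ) :
    (FockSpace d →L[ℂ] FockSpace d) →ₗ[ℂ] (FockSpace d →L[ℂ] FockSpace d) where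
  toFun := homogeneousPart n
  map_add' A B := by
    simp [homogeneousPart, wordCoeff, add_smul, Finset.sum_add_distrib]
  map_smul' c A := by
    simp [homogeneousPart, wordCoeff, mul_smul, Finset.smul_sum]

@[simp]
theorem homogeneousPartₗ_apply (n : ℕ) (A : FockSpace d →L[ℂ] FockSpace d) :
    homogeneousPartₗ d n A = homogeneousPart n A :=
  rfl

/-- Both sides lie in the right commutant, so it suffices to compare them at `ξ_∅`, where `B ξ_∅` is
expanded by degree and triangularity of `A` leaves only the degrees `j ≤ n`. -/
theorem homogeneousPart_mul {A B : FockSpace d →L[ℂ] FockSpace d} (hA : A ∈ rightCommutant d)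
    (n : ℕ) :
    homogeneousPart n (A * B) =
      ∑ j ∈ Finset.range (n + 1), homogeneousPart (n - j) A * homogeneousPart j B := by
  refine rightCommutant_ext (homogeneousPart_mem_rightCommutant _ _)
    (sum_mem fun j _ => mul_mem (homogeneousPart_mem_rightCommutant _ _)
      (homogeneousPart_mem_rightCommutant _ _)) ?_
  rw [homogeneousPart_fockBasis_one, sum_apply]
  change degreeProj d n (A (B (fockBasis 1))) =
    ∑ j ∈ Finset.range (n + 1), homogeneousPart (n - j) A (homogeneousPart j B (fockBasis 1))
  simp only [homogeneousPart_fockBasis_one]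
  have h := (degreeProj d n ∘L A).hasSum ((isGrading_degreeProj d).hasSum (B (fockBasis 1)))
  simp only [ContinuousLinearMap.comp_apply, degreeProj_apply_degreeProj hA] at h
  refine h.unique ?_
  rw [Finset.sum_congr rfl fun j hj => (if_pos (Nat.lt_succ_iff.1 (Finset.mem_range.1 hj))).symm]
  exact hasSum_sum_of_ne_finset_zero fun j hj => if_neg fun h =>
    hj (Finset.mem_range.2 (Nat.lt_succ_of_le h))

theorem homogeneousPart_of_isHomogeneousPolynomial {m : ℕ} {A : FockSpace d →L[ℂ] FockSpace d}
    (hA : IsHomogeneousPolynomial m A) (n : ℕ) :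
    homogeneousPart n A = if n = m then A else 0 := by
  have h : Set.EqOn (homogeneousPartₗ d n)
      (if n = m then LinearMap.id else 0 : _ →ₗ[ℂ] (FockSpace d →L[ℂ] FockSpace d))
      {B | ∃ w : FreeMonoid (Fin d), w.length = m ∧ B = leftRegular w} := by
    rintro _ ⟨w, rfl, rfl⟩
    refine rightCommutant_ext (homogeneousPart_mem_rightCommutant _ _) ?_ ?_
    · split_ifs
      · exact leftRegular_mem_rightCommutant w
      · exact zero_mem _
    · rw [homogeneousPartₗ_apply, homogeneousPart_fockBasis_one, leftRegular_fockBasis, mul_one,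
        degreeProj_fockBasis]
      simp only [eq_comm (a := w.length)]
      split_ifs
      · simp [leftRegular_fockBasis]
      · rfl
  have := LinearMap.eqOn_span h hA
  split_ifs at this ⊢ <;> exact this

theorem continuous_homogeneousPart_wot (n : ℕ) :
    Continuous fun A : FockSpace d →WOT[ℂ] FockSpace d =>
      ContinuousLinearMapWOT.ofCLM (homogeneousPart n A.toCLM) := by
  have h : (fun A : FockSpace d →WOT[ℂ] FockSpace d =>
      ContinuousLinearMapWOT.ofCLM (homogeneousPart n A.toCLM)) = fun A =>
      ∑ v : Fin n → Fin d, (inner ℂ (fockBasis (wordOfFn v)) (A (fockBasis 1)) : ℂ) •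
        ContinuousLinearMapWOT.ofCLM (leftRegular (wordOfFn v)) := by
    ext1 A
    exact map_sum (ContinuousLinearMapWOT.addEquiv (σ := RingHom.id ℂ)).symm _ _
  rw [h]
  exact continuous_finsetSum _ fun v _ => (continuous_inner_wot _ _).smul continuous_const

variable {J : Submodule ℂ (FockSpace d →L[ℂ] FockSpace d)}

theorem IsHomogeneousIdeal.isWOTClosedIdeal (hJ : IsHomogeneousIdeal J) : IsWOTClosedIdeal J := by
  obtain ⟨G, -, h⟩ := hJ
  exact h.1.1

theorem IsHomogeneousIdeal.homogeneousPart_mem (hJ : IsHomogeneousIdeal J)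
    {A : FockSpace d →L[ℂ] FockSpace d} (hA : A ∈ J) (n : ℕ) : homogeneousPart n A ∈ J := by
  obtain ⟨G, hG, ⟨hI, hGJ⟩, hleast⟩ := hJ
  -- The elements of `J` with all homogeneous parts in `J` form a WOT-closed ideal containing the
  -- generators, so minimality of `J` gives equality.
  let J' : Submodule ℂ (FockSpace d →L[ℂ] FockSpace d) :=
    J ⊓ ⨅ n, J.comap (homogeneousPartₗ d n)
  have hmem {A : FockSpace d →L[ℂ] FockSpace d} :
      A ∈ J' ↔ A ∈ J ∧ ∀ n, homogeneousPart n A ∈ J := by simp [J']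
  have hR {A : FockSpace d →L[ℂ] FockSpace d} (hA : A ∈ freeSemigroupAlgebra d) :
      A ∈ rightCommutant d := freeSemigroupAlgebra_le_rightCommutant hA
  suffices h : J ≤ J' from (hmem.1 (h hA)).2 n
  refine hleast ⟨⟨fun A hA => hI.mem_algebra A (hmem.1 hA).1, fun B hB A hA => ?_,
    fun B hB A hA => ?_, ?_⟩, fun A hA => ?_⟩
  · rw [hmem] at hA ⊢
    refine ⟨hI.mul_mem_left B hB A hA.1, fun n => ?_⟩
    rw [homogeneousPart_mul (hR hB)]
    exact sum_mem fun j _ => hI.mul_mem_left _ (_root_.homogeneousPart_mem _ _) _ (hA.2 j)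
  · rw [hmem] at hA ⊢
    refine ⟨hI.mul_mem_right B hB A hA.1, fun n => ?_⟩
    rw [homogeneousPart_mul (hR (hI.mem_algebra A hA.1))]
    exact sum_mem fun j _ => hI.mul_mem_right _ (_root_.homogeneousPart_mem _ _) _ (hA.2 _)
  · have h : (ContinuousLinearMapWOT.toCLM ⁻¹' (J' : Set (FockSpace d →L[ℂ] FockSpace d)) :
        Set (FockSpace d →WOT[ℂ] FockSpace d)) = ContinuousLinearMapWOT.toCLM ⁻¹' (J : Set _) ∩
        ⋂ n, (fun A => ContinuousLinearMapWOT.ofCLM (homogeneousPart n A.toCLM)) ⁻¹'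
          (ContinuousLinearMapWOT.toCLM ⁻¹' (J : Set _)) := by
      ext A
      simp [hmem]
    rw [IsWOTClosed, h]
    exact hI.isWOTClosed.inter (isClosed_iInter fun n =>
      hI.isWOTClosed.preimage (continuous_homogeneousPart_wot n))
  · obtain ⟨m, hm⟩ := hG A hA
    refine hmem.2 ⟨hGJ hA, fun n => ?_⟩
    rw [homogeneousPart_of_isHomogeneousPolynomial hm]
    split_ifs
    · exact hGJ hA
    · exact zero_mem _

end HomogeneousIdeal

/-! ### The grading of the coinvariant subspace and the compressed Cesàro maps -/

section Compression

variable {d : ℕ} {J : Submodule ℂ (FockSpace d →L[ℂ] FockSpace d)}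

theorem mem_coinvariantSubspace {x : FockSpace d} :
    x ∈ coinvariantSubspace J ↔ ∀ A ∈ J, inner ℂ (A (fockBasis 1)) x = (0 : ℂ) := by
  simp [coinvariantSubspace, Submodule.mem_orthogonal]

theorem inner_compression (A : FockSpace d →L[ℂ] FockSpace d) (x y : coinvariantSubspace J) :
    inner ℂ y (compression J A x) = (inner ℂ (y : FockSpace d) (A x) : ℂ) := by
  simp [compression]

theorem compression_apply_of_mem {A : FockSpace d →L[ℂ] FockSpace d} {x : coinvariantSubspace J}
    (h : A x ∈ coinvariantSubspace J) : (compression J A x : FockSpace d) = A x :=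
  Submodule.starProjection_eq_self_iff.2 h

/-- The projection `E_n` sends `A ξ_∅` to the value at `ξ_∅` of the degree `n` part of `A`, which is
again in `J`. Thus `J ξ_∅` is invariant under `E_n`, and so is its orthogonal complement. -/
theorem IsHomogeneousIdeal.degreeProj_mem (hJ : IsHomogeneousIdeal J) (n : ℕ) {x : FockSpace d}
    (hx : x ∈ coinvariantSubspace J) : degreeProj d n x ∈ coinvariantSubspace J := by
  rw [mem_coinvariantSubspace] at hx ⊢
  intro A hA
  rw [← (isGrading_degreeProj d).symm, ← homogeneousPart_fockBasis_one]
  exact hx _ (hJ.homogeneousPart_mem hA n)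

theorem IsHomogeneousIdeal.coe_compression_degreeProj (hJ : IsHomogeneousIdeal J) (n : ℕ)
    (x : coinvariantSubspace J) :
    (compression J (degreeProj d n) x : FockSpace d) = degreeProj d n x :=
  compression_apply_of_mem (hJ.degreeProj_mem n x.2)

theorem IsHomogeneousIdeal.isGrading (hJ : IsHomogeneousIdeal J) :
    IsGrading fun n => compression J (degreeProj d n) where
  symm n x y := by
    rw [inner_compression, ← (isGrading_degreeProj d).symm, ← hJ.coe_compression_degreeProj]
    rfl
  idem n x := by
    apply Subtype.ext
    simp only [hJ.coe_compression_degreeProj, (isGrading_degreeProj d).idem]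
  orth m n x h := by
    apply Subtype.ext
    simp only [hJ.coe_compression_degreeProj, (isGrading_degreeProj d).orth m n _ h]
    rfl
  total x hx := by
    refine Subtype.ext ((isGrading_degreeProj d).total _ fun n => ?_)
    rw [← hJ.coe_compression_degreeProj, hx]
    rfl

theorem IsHomogeneousIdeal.coe_windowProj (hJ : IsHomogeneousIdeal J) (k s : ℕ)
    (x : coinvariantSubspace J) :
    (windowProj (fun n => compression J (degreeProj d n)) k s x : FockSpace d) =
      windowProj (degreeProj d) k s x := by
  simp [windowProj_apply, hJ.coe_compression_degreeProj]

/-- The windows of `N_J` are restrictions of the windows of the Fock space, so both sides have the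
same sesquilinear form. -/
theorem IsHomogeneousIdeal.cesaro_compression (hJ : IsHomogeneousIdeal J)
    {A : FockSpace d →L[ℂ] FockSpace d} (hA : A ∈ freeSemigroupAlgebra d) (k : ℕ) :
    hJ.isGrading.cesaro k (compression J A) = compression J (cesaroMap k A) := by
  ext1 x
  refine ext_inner_left ℂ fun y => ?_
  rw [inner_compression, ← cesaro_eq_cesaroMap (freeSemigroupAlgebra_le_rightCommutant hA),
    IsGrading.inner_cesaro, IsGrading.inner_cesaro]
  simp only [inner_compression, hJ.coe_windowProj]

theorem IsHomogeneousIdeal.cesaro_mem (hJ : IsHomogeneousIdeal J) (k : ℕ)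
    {B : coinvariantSubspace J →L[ℂ] coinvariantSubspace J} (hB : B ∈ compressionAlgebra J) :
    hJ.isGrading.cesaro k B ∈ compressionAlgebra J := by
  obtain ⟨A, hA, rfl⟩ := hB
  rw [hJ.cesaro_compression hA]
  exact compression_mem J (cesaroMap_mem k A)

/-- The Cesàro map on the compression algebra. -/
def IsHomogeneousIdeal.cesaro (hJ : IsHomogeneousIdeal J) (k : ℕ) :
    compressionAlgebra J →ₗ[ℂ] compressionAlgebra J :=
  hJ.isGrading.cesaroOn fun _ hB => hJ.cesaro_mem k hB

variable (J) in
/-- The span of the compressions of the `L_w` with `|w| < k`. -/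
def compressedPolynomials (k : ℕ) :
    Submodule ℂ (coinvariantSubspace J →L[ℂ] coinvariantSubspace J) :=
  Submodule.span ℂ (Set.range fun p : Σ n : Fin k, Fin n → Fin d =>
    compression J (leftRegular (wordOfFn p.2)))

instance (k : ℕ) : FiniteDimensional ℂ (compressedPolynomials J k) :=
  FiniteDimensional.span_of_finite ℂ (Set.finite_range _)

theorem compressedPolynomials_le (k : ℕ) : compressedPolynomials J k ≤ compressionAlgebra J :=
  Submodule.span_le.2 <| Set.range_subset_iff.2 fun _ => compression_mem J (leftRegular_mem _)

theorem compression_cesaroMap_mem (k : ℕ) (A : FockSpace d →L[ℂ] FockSpace d) :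
    compression J (cesaroMap k A) ∈ compressedPolynomials J k := by
  rw [cesaroMap_eq_sum, map_sum]
  refine sum_mem fun n hn => ?_
  rw [map_smul, homogeneousPart, map_sum]
  refine Submodule.smul_mem _ _ (sum_mem fun v _ => ?_)
  rw [map_smul]
  exact Submodule.smul_mem _ _ (Submodule.subset_span ⟨⟨⟨n, Finset.mem_range.1 hn⟩, v⟩, rfl⟩)

theorem IsHomogeneousIdeal.cesaro_mem_compressedPolynomials (hJ : IsHomogeneousIdeal J) (k : ℕ)
    {B : coinvariantSubspace J →L[ℂ] coinvariantSubspace J} (hB : B ∈ compressionAlgebra J) :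
    hJ.isGrading.cesaro k B ∈ compressedPolynomials J k := by
  obtain ⟨A, hA, rfl⟩ := hB
  rw [hJ.cesaro_compression hA]
  exact compression_cesaroMap_mem k A

theorem IsHomogeneousIdeal.isCCFiniteRankNormal_cesaro (hJ : IsHomogeneousIdeal J) (k : ℕ) :
    IsCCFiniteRankNormal (hJ.cesaro k) :=
  hJ.isGrading.isCCFiniteRankNormal_cesaroOn _ (compressedPolynomials J k)
    fun _ hB => hJ.cesaro_mem_compressedPolynomials k hB

end Compression

/-! ### Hahn–Banach for a semi-inner product -/

section HahnBanach

/-- Hahn–Banach for functionals dominated by the seminorm of a semi-inner product. -/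
theorem PreInnerProductSpace.Core.exists_extension {V : Type*} [AddCommGroup V] [Module ℂ V]
    (c : PreInnerProductSpace.Core ℂ V) (p : Submodule ℂ V) (φ : p →ₗ[ℂ] ℂ)
    (hφ : ∀ x : p, ‖φ x‖ ^ 2 ≤ RCLike.re (c.inner x x)) :
    ∃ ψ : V →ₗ[ℂ] ℂ, (∀ x : p, ψ x = φ x) ∧ ∀ x, ‖ψ x‖ ^ 2 ≤ RCLike.re (c.inner x x) := by
  let _ : SeminormedAddCommGroup V :=
    @InnerProductSpace.Core.toSeminormedAddCommGroup ℂ V _ _ _ c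
  let _ : NormedSpace ℂ V := @InnerProductSpace.Core.toNormedSpace ℂ V _ _ _ c
  have hn (x : V) : ‖x‖ ^ 2 = RCLike.re (c.inner x x) :=
    Real.sq_sqrt (c.re_inner_nonneg x)
  have hb (x : p) : ‖φ x‖ ≤ 1 * ‖x‖ := by
    rw [one_mul]
    exact le_of_sq_le_sq ((hφ x).trans_eq (hn x).symm) (norm_nonneg _)
  obtain ⟨ψ, h1, h2⟩ := exists_extension_norm_eq p (φ.mkContinuous 1 hb)
  refine ⟨ψ, h1, fun x => ?_⟩
  rw [← hn]
  refine pow_le_pow_left₀ (norm_nonneg _) ((ψ.le_opNorm x).trans ?_) 2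
  rw [h2]
  exact mul_le_of_le_one_left (norm_nonneg _) (φ.mkContinuous_norm_le zero_le_one hb)

end HahnBanach

/-! ### Lifting operators that commute with the adjoints of the right shifts -/

section CommutantLifting

variable {d : ℕ}

/-- The adjoint of the right creation operator `R_i`. -/
def rightAnnihilation (i : Fin d) : FockSpace d →L[ℂ] FockSpace d :=
  (rightRegular (FreeMonoid.of i)).adjoint

theorem FreeMonoid.eq_one_or_eq_mul_of {α : Type*} (w : FreeMonoid α) :
    w = 1 ∨ ∃ u i, w = u * FreeMonoid.of i := by
  rcases List.eq_nil_or_concat w.toList with h | ⟨l, a, h⟩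
  · exact Or.inl (FreeMonoid.toList.injective h)
  · exact Or.inr ⟨FreeMonoid.ofList l, a, FreeMonoid.toList.injective (by simpa using h)⟩

theorem inner_rightAnnihilation_left (i : Fin d) (x y : FockSpace d) :
    inner ℂ (rightAnnihilation i x) y = (inner ℂ x (rightRegular (FreeMonoid.of i) y) : ℂ) :=
  ContinuousLinearMap.adjoint_inner_left _ _ _

theorem norm_fockBasis (w : FreeMonoid (Fin d)) : ‖fockBasis w‖ = 1 := by
  simp [fockBasis, lp.norm_single]

theorem rightAnnihilation_coord (i : Fin d) (x : FockSpace d) (w : FreeMonoid (Fin d)) :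
    rightAnnihilation i x w = x (w * FreeMonoid.of i) := by
  rw [← inner_fockBasis, rightAnnihilation, ContinuousLinearMap.adjoint_inner_right,
    rightRegular_fockBasis, inner_fockBasis]

theorem rightAnnihilation_fockBasis_one (i : Fin d) :
    rightAnnihilation i (fockBasis 1) = 0 := by
  classical
  ext w
  rw [rightAnnihilation_coord, fockBasis_apply, if_neg]
  · rfl
  · intro h
    simpa using congrArg FreeMonoid.length h

theorem rightAnnihilation_fockBasis_mul (i j : Fin d) (u : FreeMonoid (Fin d)) :
    rightAnnihilation i (fockBasis (u * FreeMonoid.of j)) = if i = j then fockBasis u else 0 := by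
  classical
  ext w
  rw [rightAnnihilation_coord, fockBasis_apply]
  have h : w * FreeMonoid.of i = u * FreeMonoid.of j ↔ w = u ∧ i = j := by
    constructor
    · intro h
      have := List.append_inj' (congrArg FreeMonoid.toList h) rfl
      exact ⟨FreeMonoid.toList.injective this.1, by simpa using this.2⟩
    · rintro ⟨rfl, rfl⟩
      rfl
  simp only [h]
  by_cases hij : i = j
  · simp [hij, fockBasis_apply]
  · simp [hij]

theorem rightAnnihilation_rightRegular (i j : Fin d) (x : FockSpace d) :
    rightAnnihilation i (rightRegular (FreeMonoid.of j) x) = if i = j then x else 0 := by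
  suffices h : rightAnnihilation i ∘L rightRegular (FreeMonoid.of j) =
      if i = j then ContinuousLinearMap.id ℂ _ else 0 by
    have := DFunLike.congr_fun h x
    split_ifs at this ⊢ <;> exact this
  refine fockSpace_clm_ext fun w => ?_
  rw [ContinuousLinearMap.comp_apply, rightRegular_fockBasis, rightAnnihilation_fockBasis_mul]
  split_ifs <;> rfl

/-- Every nonempty word has a unique last letter, so the ranges of the `R_i` and the vacuum line
span the Fock space. -/
theorem sum_rightRegular_rightAnnihilation (x : FockSpace d) :
    ∑ i, rightRegular (FreeMonoid.of i) (rightAnnihilation i x) + x 1 • fockBasis 1 = x := by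
  classical
  suffices h : ∑ i, rightRegular (FreeMonoid.of i) ∘L rightAnnihilation i +
      (innerSL ℂ (fockBasis 1)).smulRight (fockBasis 1) = ContinuousLinearMap.id ℂ (FockSpace d) by
    have := DFunLike.congr_fun h x
    simpa [inner_fockBasis] using this
  refine fockSpace_clm_ext fun w => ?_
  rcases w.eq_one_or_eq_mul_of with rfl | ⟨u, j, rfl⟩
  · simp [rightAnnihilation_fockBasis_one, norm_fockBasis]
  · have h1 : (1 : FreeMonoid (Fin d)) ≠ u * FreeMonoid.of j := fun h => by
      simpa using congrArg FreeMonoid.length h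
    simp [rightAnnihilation_fockBasis_mul, inner_fockBasis, fockBasis_apply, h1,
      apply_ite (rightRegular (d := d) _), rightRegular_fockBasis]

theorem norm_sq_eq_sum_rightAnnihilation (x : FockSpace d) :
    ‖x‖ ^ 2 = ∑ i, ‖rightAnnihilation i x‖ ^ 2 + ‖x 1‖ ^ 2 := by
  have h : (inner ℂ x x : ℂ) = inner ℂ x
      (∑ i, rightRegular (FreeMonoid.of i) (rightAnnihilation i x) + x 1 • fockBasis 1) := by
    rw [sum_rightRegular_rightAnnihilation]
  rw [inner_add_right, inner_sum, inner_smul_right, ← inner_conj_symm x (fockBasis 1),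
    inner_fockBasis, RCLike.mul_conj, inner_self_eq_norm_sq_to_K] at h
  simp only [← inner_rightAnnihilation_left,
    inner_self_eq_norm_sq_to_K] at h
  exact_mod_cast h

/-- `f` is a bounded partially defined operator that commutes with the adjoints of the `R_i`. -/
structure IsPartialLift (C : ℝ) (f : FockSpace d →ₗ.[ℂ] FockSpace d) : Prop where
  mem : ∀ i, ∀ x ∈ f.domain, rightAnnihilation i x ∈ f.domain
  comm : ∀ i (x : f.domain), f ⟨rightAnnihilation i x, mem i x x.2⟩ = rightAnnihilation i (f x)
  bound : ∀ x : f.domain, ‖f x‖ ^ 2 ≤ C ^ 2 * ‖x‖ ^ 2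

namespace IsPartialLift

variable {C : ℝ} {f : FockSpace d →ₗ.[ℂ] FockSpace d}

/-- A partial lift extends to all vectors that the adjoints of the `R_i` map to its domain. -/
theorem exists_extension (hf : IsPartialLift C f) :
    ∃ g, f ≤ g ∧ IsPartialLift C g ∧
      ∀ x, (∀ i, rightAnnihilation i x ∈ f.domain) → x ∈ g.domain := by
  let D : Submodule ℂ (FockSpace d) :=
    ⨅ i, f.domain.comap (rightAnnihilation i).toLinearMap
  have hD {x : FockSpace d} : x ∈ D ↔ ∀ i, rightAnnihilation i x ∈ f.domain := by simp [D]
  have hfD : f.domain ≤ D := fun x hx => hD.2 fun i => hf.mem i x hx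
  let g (i : Fin d) : D →ₗ[ℂ] FockSpace d :=
    f.toFun ∘ₗ (rightAnnihilation i).toLinearMap.restrict fun x hx => hD.1 hx i
  have hgf (i : Fin d) (x : D) (hx : (x : FockSpace d) ∈ f.domain) :
      g i x = rightAnnihilation i (f ⟨x, hx⟩) := hf.comm i ⟨x, hx⟩
  have hgb (x : D) : ∑ i, ‖g i x‖ ^ 2 ≤ C ^ 2 * ‖x‖ ^ 2 := by
    calc ∑ i, ‖g i x‖ ^ 2 ≤ ∑ i, C ^ 2 * ‖rightAnnihilation i (x : FockSpace d)‖ ^ 2 :=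
          Finset.sum_le_sum fun i _ => hf.bound _
      _ ≤ C ^ 2 * ‖(x : FockSpace d)‖ ^ 2 := by
          rw [← Finset.mul_sum, norm_sq_eq_sum_rightAnnihilation (x : FockSpace d)]
          gcongr
          exact le_add_of_nonneg_right (by positivity)
  have hre (x : D) : RCLike.re ((C : ℂ) ^ 2 * inner ℂ x x - ∑ i, inner ℂ (g i x) (g i x) : ℂ) =
      C ^ 2 * ‖x‖ ^ 2 - ∑ i, ‖g i x‖ ^ 2 := by
    have h : ((C : ℂ) ^ 2 * inner ℂ x x - ∑ i, inner ℂ (g i x) (g i x) : ℂ) =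
        ((C ^ 2 * ‖x‖ ^ 2 - ∑ i, ‖g i x‖ ^ 2 : ℝ) : ℂ) := by
      simp only [Submodule.coe_inner, inner_self_eq_norm_sq_to_K]
      push_cast
      rfl
    rw [h]
    exact Complex.ofReal_re _
  -- Commutation forces `R_i*` of the new value at `x` to be `g i x`, so only its `ξ_∅`-coordinate
  -- is free. The norm bound leaves `C²‖x‖² - ∑ ‖g i x‖²` for the square of that coordinate; this
  -- form is nonnegative by the bound on `f`.
  let c : PreInnerProductSpace.Core ℂ D :=
    { inner := fun x y => (C : ℂ) ^ 2 * inner ℂ x y - ∑ i, inner ℂ (g i x) (g i y)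
      conj_inner_symm := fun x y => by simp
      re_inner_nonneg := fun x => by
        rw [hre]
        exact sub_nonneg.2 (hgb x)
      add_left := fun x y z => by
        simp only [inner_add_left, map_add, Finset.sum_add_distrib]
        ring
      smul_left := fun x y r => by
        simp only [inner_smul_left, map_smul, ← Finset.mul_sum]
        ring }
  let φ : f.domain.comap D.subtype →ₗ[ℂ] ℂ :=
    (innerSL ℂ (fockBasis (1 : FreeMonoid (Fin d)))).toLinearMap ∘ₗ f.toFun ∘ₗ
      D.subtype.restrict (p := f.domain.comap D.subtype) fun x hx => hx
  have hφ (x : f.domain.comap D.subtype) : φ x = f ⟨x, x.2⟩ 1 := inner_fockBasis _ _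
  -- On the old domain the coordinate of `f x` obeys this bound by Pythagoras for `f x`, since there
  -- `g i x = R_i* (f x)`.
  obtain ⟨ψ, hψφ, hψ⟩ := c.exists_extension _ φ fun x => by
    refine le_of_le_of_eq ?_ (hre x).symm
    have h1 := norm_sq_eq_sum_rightAnnihilation (f ⟨x, x.2⟩)
    have h2 := hf.bound ⟨x, x.2⟩
    simp only [hgf _ x.1 x.2, hφ]
    have h3 : ‖(x : D)‖ = ‖(⟨x, x.2⟩ : f.domain)‖ := rfl
    rw [h3]
    linarith
  let k : D →ₗ[ℂ] FockSpace d :=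
    ∑ i, (rightRegular (FreeMonoid.of i)).toLinearMap ∘ₗ g i + ψ.smulRight (fockBasis 1)
  have hk (x : D) : k x = ∑ i, rightRegular (FreeMonoid.of i) (g i x) + ψ x • fockBasis 1 := by
    simp [k]
  have hkf (x : D) (hx : (x : FockSpace d) ∈ f.domain) : k x = f ⟨x, hx⟩ := by
    rw [hk, hψφ ⟨x, hx⟩, hφ]
    simp only [hgf _ x hx]
    exact sum_rightRegular_rightAnnihilation _
  have hkR (i : Fin d) (x : D) : rightAnnihilation i (k x) = g i x := by
    simp [hk, rightAnnihilation_rightRegular, rightAnnihilation_fockBasis_one]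
  refine ⟨⟨D, k⟩, ⟨hfD, ?_⟩, ⟨?_, ?_, ?_⟩, fun x hx => hD.2 hx⟩
  · rintro ⟨x, hx⟩ ⟨y, hy⟩ (rfl : x = y)
    exact (hkf ⟨x, hy⟩ hx).symm
  · exact fun i x hx => hfD (hD.1 hx i)
  · intro i x
    exact (hkf _ (hD.1 x.2 i)).trans (hkR i x).symm
  · intro x
    change ‖k x‖ ^ 2 ≤ C ^ 2 * ‖x‖ ^ 2
    have h1 : k x 1 = ψ x := by
      rw [← inner_fockBasis, hk, inner_add_right, inner_sum, inner_smul_right,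
        Finset.sum_eq_zero, inner_self_eq_norm_sq_to_K]
      · simp [fockBasis, lp.norm_single]
      · intro i _
        rw [← inner_rightAnnihilation_left, rightAnnihilation_fockBasis_one, inner_zero_left]
    have h2 := (hψ x).trans_eq (hre x)
    rw [norm_sq_eq_sum_rightAnnihilation, h1]
    simp only [hkR]
    linarith

theorem sSup {c : Set (FockSpace d →ₗ.[ℂ] FockSpace d)} (hc : IsChain (· ≤ ·) c)
    (hne : c.Nonempty) (h : ∀ g ∈ c, IsPartialLift C g) :
    IsPartialLift C (LinearPMap.sSup c hc.directedOn) := by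
  have hmem (x : FockSpace d) : x ∈ (LinearPMap.sSup c hc.directedOn).domain ↔
      ∃ g ∈ c, x ∈ g.domain := LinearPMap.mem_domain_sSup_iff hne hc.directedOn
  have happ (g : FockSpace d →ₗ.[ℂ] FockSpace d) (hg : g ∈ c) (x : FockSpace d)
      (hx : x ∈ g.domain) (hx' : x ∈ (LinearPMap.sSup c hc.directedOn).domain) :
      LinearPMap.sSup c hc.directedOn ⟨x, hx'⟩ = g ⟨x, hx⟩ :=
    LinearPMap.sSup_apply hc.directedOn hg ⟨x, hx⟩
  refine ⟨fun i x hx => ?_, ?_, ?_⟩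
  · obtain ⟨g, hg, hxg⟩ := (hmem x).1 hx
    exact (hmem _).2 ⟨g, hg, (h g hg).mem i x hxg⟩
  · rintro i ⟨x, hx⟩
    obtain ⟨g, hg, hxg⟩ := (hmem x).1 hx
    rw [happ g hg x hxg, happ g hg _ ((h g hg).mem i x hxg)]
    exact (h g hg).comm i ⟨x, hxg⟩
  · rintro ⟨x, hx⟩
    obtain ⟨g, hg, hxg⟩ := (hmem x).1 hx
    rw [happ g hg x hxg]
    exact (h g hg).bound ⟨x, hxg⟩

/-- A partial lift extends to an operator on the Fock space. -/
theorem exists_clm (hf : IsPartialLift C f) :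
    ∃ X : FockSpace d →L[ℂ] FockSpace d, (∀ x : f.domain, X x = f x) ∧
      ∀ i x, X (rightAnnihilation i x) = rightAnnihilation i (X x) := by
  classical
  obtain ⟨g, hfg, hg⟩ := zorn_le_nonempty₀ {g | IsPartialLift C g}
    (fun c hcs hc y hy => ⟨LinearPMap.sSup c hc.directedOn, .sSup hc ⟨y, hy⟩ hcs,
      fun z hz => LinearPMap.le_sSup hc.directedOn hz⟩) f hf
  have hgl : IsPartialLift C g := hg.prop
  have hmax (x : FockSpace d) (hx : ∀ i, rightAnnihilation i x ∈ g.domain) : x ∈ g.domain := by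
    obtain ⟨k, hgk, hk, hk'⟩ := hgl.exists_extension
    exact (hg.le_of_ge hk hgk).1 (hk' x hx)
  -- `R_i*` deletes the last letter `i` or gives zero, so maximality puts all basis vectors in the
  -- domain by induction on the length.
  have hbasis (l : List (Fin d)) : fockBasis (FreeMonoid.ofList l) ∈ g.domain := by
    induction l using List.reverseRecOn with
    | nil =>
      refine hmax _ fun i => ?_
      rw [FreeMonoid.ofList_nil, rightAnnihilation_fockBasis_one]
      exact zero_mem _
    | append_singleton l a ih =>
      refine hmax _ fun i => ?_
      rw [FreeMonoid.ofList_append, FreeMonoid.ofList_singleton, rightAnnihilation_fockBasis_mul]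
      split_ifs
      · exact ih
      · exact zero_mem _
  have hdense : DenseRange g.domain.subtypeL := by
    intro x
    have hx := lp.hasSum_single (by norm_num) x
    refine mem_closure_of_tendsto hx (.of_forall fun s => ?_)
    refine ⟨⟨_, sum_mem (t := s) (f := fun w => lp.single 2 w (x w)) fun w _ => ?_⟩, rfl⟩
    have := g.domain.smul_mem (x w) (hbasis w.toList)
    rwa [fockBasis, ← lp.single_smul, smul_eq_mul, mul_one] at this
  have hC (x : g.domain) : ‖g.toFun x‖ ≤ |C| * ‖x‖ := by
    refine le_of_sq_le_sq ?_ (by positivity)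
    rw [mul_pow, sq_abs]
    exact hgl.bound x
  let X := (g.toFun.mkContinuous |C| hC).extend g.domain.subtypeL
  have hX (x : g.domain) : X x = g x :=
    ContinuousLinearMap.extend_eq _ hdense g.domain.subtypeₗᵢ.isometry.isUniformInducing x
  refine ⟨X, fun x => ?_, fun i => ?_⟩
  · rw [hfg.2 (x := x) (y := ⟨x, hfg.1 x.2⟩) rfl]
    exact hX ⟨x, hfg.1 x.2⟩
  · suffices h : X ∘L rightAnnihilation i = rightAnnihilation i ∘L X from DFunLike.congr_fun h
    refine fockSpace_clm_ext fun w => ?_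
    have hw := hbasis w.toList
    have h1 := hX ⟨_, hgl.mem i _ hw⟩
    have h2 := hX ⟨_, hw⟩
    have h3 := hgl.comm i ⟨_, hw⟩
    rw [← h1, ← h2] at h3
    exact h3

end IsPartialLift

end CommutantLifting

/-! ### The compression algebra as a commutant, and its weak*-closedness -/

section Closed

variable {d : ℕ} {J : Submodule ℂ (FockSpace d →L[ℂ] FockSpace d)}

theorem mem_rightCommutant_of_generators {A : FockSpace d →L[ℂ] FockSpace d}
    (h : ∀ i x, rightRegular (FreeMonoid.of i) (A x) = A (rightRegular (FreeMonoid.of i) x)) :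
    A ∈ rightCommutant d := by
  have hmul (u v : FreeMonoid (Fin d)) (x : FockSpace d) :
      rightRegular (u * v) x = rightRegular v (rightRegular u x) := by
    suffices h : rightRegular (u * v) = rightRegular v ∘L rightRegular u from DFunLike.congr_fun h x
    exact fockSpace_clm_ext fun w => by simp [rightRegular_fockBasis, mul_assoc]
  have hone (x : FockSpace d) : rightRegular 1 x = x := by
    suffices h : rightRegular 1 = ContinuousLinearMap.id ℂ (FockSpace d) from DFunLike.congr_fun h x
    exact fockSpace_clm_ext fun w => by simp [rightRegular_fockBasis]
  refine mem_rightCommutant.2 fun u => ?_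
  induction u using FreeMonoid.inductionOn' with
  | one => simp [hone]
  | of_mul i u ih => intro x; rw [hmul, hmul, h, ih]

theorem IsWOTClosedIdeal.adjoint_mem (hJ : IsWOTClosedIdeal J) {A : FockSpace d →L[ℂ] FockSpace d}
    (hA : A ∈ freeSemigroupAlgebra d) {x : FockSpace d} (hx : x ∈ coinvariantSubspace J) :
    A.adjoint x ∈ coinvariantSubspace J := by
  rw [mem_coinvariantSubspace] at hx ⊢
  intro B hB
  rw [ContinuousLinearMap.adjoint_inner_right]
  exact hx _ (hJ.mul_mem_left A hA B hB)

/-- For `B` in `J`, `R_i B ξ_∅ = B R_i ξ_∅ = B L_i ξ_∅`, and `B L_i` is in `J`; so `J ξ_∅` is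
invariant under `R_i`. -/
theorem IsWOTClosedIdeal.rightAnnihilation_mem (hJ : IsWOTClosedIdeal J) (i : Fin d)
    {x : FockSpace d} (hx : x ∈ coinvariantSubspace J) :
    rightAnnihilation i x ∈ coinvariantSubspace J := by
  rw [mem_coinvariantSubspace] at hx ⊢
  intro B hB
  rw [rightAnnihilation, ContinuousLinearMap.adjoint_inner_right,
    mem_rightCommutant.1 (freeSemigroupAlgebra_le_rightCommutant (hJ.mem_algebra B hB)),
    rightRegular_fockBasis, one_mul, ← mul_one (FreeMonoid.of i), ← leftRegular_fockBasis]
  exact hx _ (hJ.mul_mem_right _ (leftRegular_mem _) B hB)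

/-- The compression algebra is the commutant of the compressed right shifts. -/
theorem IsWOTClosedIdeal.mem_compressionAlgebra_iff (hJ : IsWOTClosedIdeal J)
    {B : coinvariantSubspace J →L[ℂ] coinvariantSubspace J} :
    B ∈ compressionAlgebra J ↔ ∀ i (x y : coinvariantSubspace J),
      (inner ℂ y (B (compression J (rightRegular (FreeMonoid.of i)) x)) : ℂ) =
        inner ℂ (⟨rightAnnihilation i y, hJ.rightAnnihilation_mem i y.2⟩ : coinvariantSubspace J)
          (B x) := by
  constructor
  · rintro ⟨A, hA, rfl⟩ i x y
    rw [inner_compression, inner_compression, ← ContinuousLinearMap.adjoint_inner_left]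
    have h := inner_compression (J := J) (rightRegular (FreeMonoid.of i)) x
      ⟨A.adjoint y, hJ.adjoint_mem hA y.2⟩
    rw [Submodule.coe_inner] at h
    rw [h, ContinuousLinearMap.adjoint_inner_left,
      ← mem_rightCommutant.1 (freeSemigroupAlgebra_le_rightCommutant hA)]
    exact (inner_rightAnnihilation_left _ _ _).symm
  · intro h
    -- The hypothesis says that `B*` on `N_J` commutes with the restrictions of the `R_i*`, so it is
    -- a partial lift. The adjoint of its extension commutes with the `R_i` and compresses to `B`.
    let f : FockSpace d →ₗ.[ℂ] FockSpace d :=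
      ⟨coinvariantSubspace J, (coinvariantSubspace J).subtype ∘ₗ B.adjoint.toLinearMap⟩
    have hf : IsPartialLift ‖B.adjoint‖ f := by
      refine ⟨fun i x hx => hJ.rightAnnihilation_mem i hx, fun i x => ?_, fun x => ?_⟩
      · change (B.adjoint ⟨rightAnnihilation i (x : FockSpace d), _⟩ : FockSpace d) =
          rightAnnihilation i (B.adjoint x : FockSpace d)
        refine congrArg Subtype.val (a₂ := (⟨_, hJ.rightAnnihilation_mem i (B.adjoint x).2⟩ :
          coinvariantSubspace J)) (ext_inner_right ℂ fun y => ?_)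
        rw [ContinuousLinearMap.adjoint_inner_left, ← h, ← ContinuousLinearMap.adjoint_inner_left,
          inner_compression, Submodule.coe_inner, inner_rightAnnihilation_left]
      · rw [← mul_pow]
        exact pow_le_pow_left₀ (norm_nonneg _) (B.adjoint.le_opNorm x) 2
    obtain ⟨X, hXf, hX⟩ := hf.exists_clm
    refine ⟨X.adjoint, ?_, ?_⟩
    · refine rightCommutant_le_freeSemigroupAlgebra (mem_rightCommutant_of_generators fun i x => ?_)
      refine ext_inner_left ℂ fun y => ?_
      rw [ContinuousLinearMap.adjoint_inner_right, ← ContinuousLinearMap.adjoint_inner_left,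
        ← ContinuousLinearMap.adjoint_inner_left (rightRegular (FreeMonoid.of i)),
        ContinuousLinearMap.adjoint_inner_right]
      exact congrArg (fun z => inner ℂ z x) (hX i y)
    · ext1 x
      refine ext_inner_left ℂ fun y => ?_
      rw [inner_compression, ContinuousLinearMap.adjoint_inner_right, hXf y,
        ← ContinuousLinearMap.adjoint_inner_left]
      rfl

theorem IsWOTClosedIdeal.isClosed_compressionAlgebra (hJ : IsWOTClosedIdeal J) :
    IsClosed[weakStar (coinvariantSubspace J)]
      (compressionAlgebra J : Set (coinvariantSubspace J →L[ℂ] coinvariantSubspace J)) := by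
  have h : (compressionAlgebra J : Set (coinvariantSubspace J →L[ℂ] coinvariantSubspace J)) =
      ⋂ (i) (x : coinvariantSubspace J) (y : coinvariantSubspace J),
        {B | (inner ℂ y (B (compression J (rightRegular (FreeMonoid.of i)) x)) : ℂ) =
          inner ℂ (⟨rightAnnihilation i y, hJ.rightAnnihilation_mem i y.2⟩ : coinvariantSubspace J)
            (B x)} := by
    ext B
    simp only [SetLike.mem_coe, hJ.mem_compressionAlgebra_iff, Set.mem_iInter, Set.mem_ofPred_eq]
  rw [h]
  exact @isClosed_iInter _ _ (weakStar _) _ fun i => @isClosed_iInter _ _ (weakStar _) _ fun x =>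
    @isClosed_iInter _ _ (weakStar _) _ fun y => @isClosed_eq _ _ _ (weakStar _) _ _ _
      (continuous_inner_weakStar _ _) (continuous_inner_weakStar _ _)

end Closed

/-! ### Slice maps, gradings of tensor products and property `S_σ` -/

section HilbertTensor

variable {H : Type u} [NormedAddCommGroup H] [InnerProductSpace ℂ H]
variable {K : Type v} [NormedAddCommGroup K] [InnerProductSpace ℂ K]

/-- The elementary tensor `h ⊗ k` in the Hilbert space tensor product. -/
def hilbertTmul (h : H) (k : K) : HilbertTensor H K := ((h ⊗ₜ[ℂ] k : H ⊗[ℂ] K) : HilbertTensor H K)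

@[simp]
theorem hilbertTmul_zero_left (k : K) : hilbertTmul (0 : H) k = 0 :=
  map_zero (tensorRight k)

@[simp]
theorem hilbertTmul_zero_right (h : H) : hilbertTmul h (0 : K) = 0 :=
  map_zero (tensorLeft h)

theorem tensorOperator_hilbertTmul (A : H →L[ℂ] H) (B : K →L[ℂ] K) (h : H) (k : K) :
    tensorOperator A B (hilbertTmul h k) = hilbertTmul (A h) (B k) :=
  ContinuousLinearMap.completion_apply_coe _ _

theorem inner_hilbertTmul (h h' : H) (k k' : K) :
    inner ℂ (hilbertTmul h k) (hilbertTmul h' k') = (inner ℂ h h' * inner ℂ k k' : ℂ) := by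
  simp [hilbertTmul]

theorem norm_hilbertTmul (h : H) (k : K) : ‖hilbertTmul h k‖ = ‖h‖ * ‖k‖ := by
  simp [hilbertTmul]

theorem hilbertTensor_clm_ext {F : Type*} [NormedAddCommGroup F] [NormedSpace ℂ F]
    {A B : HilbertTensor H K →L[ℂ] F}
    (hAB : ∀ h k, A (hilbertTmul h k) = B (hilbertTmul h k)) : A = B := by
  ext z
  refine UniformSpace.Completion.induction_on z (isClosed_eq A.continuous B.continuous) fun t => ?_
  induction t using TensorProduct.induction_on with
  | zero => rw [UniformSpace.Completion.coe_zero, map_zero, map_zero]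
  | tmul h k => exact hAB h k
  | add s t hs ht => rw [UniformSpace.Completion.coe_add, map_add, map_add, hs, ht]

theorem hilbertTensor_eq_zero {z : HilbertTensor H K}
    (hz : ∀ h k, inner ℂ z (hilbertTmul h k) = (0 : ℂ)) : z = 0 := by
  have h : innerSL ℂ z = 0 := hilbertTensor_clm_ext hz
  have := DFunLike.congr_fun h z
  simpa using this

theorem hilbertTensor_clm_ext_inner {A B : HilbertTensor H K →L[ℂ] HilbertTensor H K}
    (hAB : ∀ h k h' k', inner ℂ (hilbertTmul h' k') (A (hilbertTmul h k)) =
      (inner ℂ (hilbertTmul h' k') (B (hilbertTmul h k)) : ℂ)) : A = B := by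
  refine hilbertTensor_clm_ext fun h k => ?_
  rw [← sub_eq_zero]
  refine hilbertTensor_eq_zero fun h' k' => ?_
  rw [← inner_conj_symm, inner_sub_right, hAB, sub_self, map_zero]

theorem summable_norm_hilbertTmul_sq (x : lp (fun _ : ℕ => H) 2) (u : lp (fun _ : ℕ => K) 2) :
    Summable fun i : ℕ × ℕ => ‖hilbertTmul (x i.1) (u i.2)‖ ^ 2 := by
  simp only [norm_hilbertTmul, mul_pow]
  exact (summable_norm_sq x).mul_of_nonneg (summable_norm_sq u) (fun _ => by positivity)
    fun _ => by positivity

/-- The functionals `A ↦ (A x, y)` span the dual of a finite-dimensional space of operators. -/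
theorem span_vectorFunctionals_eq_top (W : Submodule ℂ (H →L[ℂ] H)) [FiniteDimensional ℂ W] :
    Submodule.span ℂ {φ : Module.Dual ℂ W | ∃ x y : H, ∀ A : W,
      φ A = inner ℂ y ((A : H →L[ℂ] H) x)} = ⊤ := by
  -- In finite dimension it is enough that the functionals separate points, and an operator whose
  -- matrix coefficients all vanish is zero.
  rw [← Subspace.dualCoannihilator_dualAnnihilator_eq (W := Submodule.span ℂ _),
    Submodule.dualAnnihilator_eq_top_iff]
  rw [eq_bot_iff]
  intro A hA
  rw [Submodule.mem_dualCoannihilator] at hA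
  refine (Submodule.mem_bot ℂ).2 (Subtype.ext ?_)
  ext x
  refine ext_inner_left ℂ fun y => ?_
  refine (hA ((innerSL ℂ y).toLinearMap ∘ₗ (ContinuousLinearMap.apply ℂ H x).toLinearMap ∘ₗ
    W.subtype) (Submodule.subset_span ⟨x, y, fun _ => rfl⟩)).trans (by simp)

theorem windowProj_tensor (E : ℕ → H →L[ℂ] H) (k s : ℕ) (h : H) (u : K) :
    windowProj (fun n => tensorOperator (E n) (ContinuousLinearMap.id ℂ K)) k s (hilbertTmul h u) =
      hilbertTmul (windowProj E k s h) u := by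
  rw [windowProj_apply, windowProj_apply]
  refine Eq.trans ?_ (map_sum (tensorRight u) _ _).symm
  exact Finset.sum_congr rfl fun n _ => tensorOperator_hilbertTmul _ _ _ _

/-- An operator whose left slices lie in a finite-dimensional space is an algebraic tensor. -/
theorem mem_span_tensorOperator {W : Submodule ℂ (H →L[ℂ] H)} [FiniteDimensional ℂ W]
    {T : Submodule ℂ (K →L[ℂ] K)} {X : HilbertTensor H K →L[ℂ] HilbertTensor H K}
    (hW : ∀ u v : K, ∃ A ∈ W, ∀ x y : H,
      inner ℂ y (A x) = (inner ℂ (hilbertTmul y v) (X (hilbertTmul x u)) : ℂ))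
    (hT : ∀ x y : H, ∃ B ∈ T, ∀ u v : K,
      inner ℂ v (B u) = (inner ℂ (hilbertTmul y v) (X (hilbertTmul x u)) : ℂ)) :
    X ∈ Submodule.span ℂ {X | ∃ A ∈ W, ∃ B ∈ T, X = tensorOperator A B} := by
  choose A hAW hA using hW
  -- Each functional on `W` is a combination of vector functionals, so applying it to the left
  -- slices `A u v` yields the form of a combination of right slices, which stays in `T`. The
  -- coordinate functionals of a basis then give the second tensor factors.
  have hdual (φ : Module.Dual ℂ W) : ∃ B ∈ T, ∀ u v : K,
      inner ℂ v (B u) = φ ⟨A u v, hAW u v⟩ := by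
    have hφ : φ ∈ Submodule.span ℂ {φ : Module.Dual ℂ W | ∃ x y : H, ∀ A : W,
        φ A = inner ℂ y ((A : H →L[ℂ] H) x)} := by
      rw [span_vectorFunctionals_eq_top W]
      exact Submodule.mem_top
    induction hφ using Submodule.span_induction with
    | mem φ h =>
      obtain ⟨x, y, h⟩ := h
      obtain ⟨B, hB, hB'⟩ := hT x y
      exact ⟨B, hB, fun u v => by rw [hB', h, hA]⟩
    | zero => exact ⟨0, zero_mem _, by simp⟩
    | add φ ψ _ _ h1 h2 =>
      obtain ⟨B, hB, hB'⟩ := h1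
      obtain ⟨C, hC, hC'⟩ := h2
      exact ⟨B + C, add_mem hB hC, fun u v => by
        rw [add_apply, inner_add_right, hB', hC', LinearMap.add_apply]⟩
    | smul c φ _ h =>
      obtain ⟨B, hB, hB'⟩ := h
      exact ⟨c • B, T.smul_mem c hB, fun u v => by
        rw [smul_apply, inner_smul_right, hB', LinearMap.smul_apply, smul_eq_mul]⟩
  let e := Module.finBasis ℂ W
  choose B hBT hB using fun j => hdual (e.coord j)
  have hX : X = ∑ j, tensorOperator (e j : H →L[ℂ] H) (B j) := by
    refine hilbertTensor_clm_ext_inner fun x u y v => ?_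
    rw [← hA, sum_apply, inner_sum]
    simp only [tensorOperator_hilbertTmul, inner_hilbertTmul, hB]
    have h := congrArg (fun C : W => (inner ℂ y ((C : H →L[ℂ] H) x) : ℂ))
      (e.sum_repr ⟨A u v, hAW u v⟩)
    simp only [Submodule.coe_sum, Submodule.coe_smul, sum_apply, smul_apply, inner_sum,
      inner_smul_right] at h
    rw [← h]
    exact Finset.sum_congr rfl fun j _ => mul_comm _ _
  rw [hX]
  exact sum_mem fun j _ => Submodule.subset_span ⟨_, (e j).2, _, hBT j, rfl⟩

variable [CompleteSpace H] [CompleteSpace K]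

/-- A grading of `H` induces a grading of `H ⊗ K`. -/
theorem IsGrading.tensor {E : ℕ → H →L[ℂ] H} (hE : IsGrading E) (K : Type v)
    [NormedAddCommGroup K] [InnerProductSpace ℂ K] [CompleteSpace K] :
    IsGrading fun n => tensorOperator (E n) (ContinuousLinearMap.id ℂ K) := by
  have hsymm (n : ℕ) (x y : HilbertTensor H K) :
      inner ℂ (tensorOperator (E n) (ContinuousLinearMap.id ℂ K) x) y =
        (inner ℂ x (tensorOperator (E n) (ContinuousLinearMap.id ℂ K) y) : ℂ) := by
    rw [← ContinuousLinearMap.adjoint_inner_right]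
    congr 1
    refine DFunLike.congr_fun (hilbertTensor_clm_ext_inner fun h k h' k' => ?_) y
    rw [ContinuousLinearMap.adjoint_inner_right, tensorOperator_hilbertTmul,
      tensorOperator_hilbertTmul, inner_hilbertTmul, inner_hilbertTmul, hE.symm]
    rfl
  refine ⟨hsymm, fun n => ?_, fun m n x hmn => ?_, fun z hz => ?_⟩
  · refine DFunLike.congr_fun (f := tensorOperator (E n) (ContinuousLinearMap.id ℂ K) ∘L
      tensorOperator (E n) (ContinuousLinearMap.id ℂ K)) (hilbertTensor_clm_ext fun h k => ?_)
    simp [tensorOperator_hilbertTmul, hE.idem]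
  · refine DFunLike.congr_fun (f := tensorOperator (E m) (ContinuousLinearMap.id ℂ K) ∘L
      tensorOperator (E n) (ContinuousLinearMap.id ℂ K)) (g := 0)
      (hilbertTensor_clm_ext fun h k => ?_) x
    simp [tensorOperator_hilbertTmul, hE.orth m n h hmn]
  · refine hilbertTensor_eq_zero fun h k => ?_
    have h1 := (innerSL ℂ z ∘L tensorRight k).hasSum (hE.hasSum h)
    have h2 (n : ℕ) : (innerSL ℂ z ∘L tensorRight k) (E n h) = 0 := by
      have := hsymm n z (hilbertTmul h k)
      rw [tensorOperator_hilbertTmul, hz, inner_zero_left] at this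
      exact this.symm
    simp only [h2] at h1
    exact h1.unique hasSum_zero

theorem inner_sliceRight (x y : lp (fun _ : ℕ => H) 2)
    (X : HilbertTensor H K →L[ℂ] HilbertTensor H K) (u v : K) :
    inner ℂ v (sliceRight x y X u) =
      (∑' n, inner ℂ (hilbertTmul (y n) v) (X (hilbertTmul (x n) u)) : ℂ) := by
  have h := (innerSL ℂ v ∘L ContinuousLinearMap.apply ℂ K u).hasSum
    (summable_sliceRight x y X).of_norm.hasSum
  refine h.tsum_eq.symm.trans (tsum_congr fun n => ?_)
  exact ContinuousLinearMap.adjoint_inner_right _ _ _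

theorem inner_sliceLeft (x y : lp (fun _ : ℕ => K) 2)
    (X : HilbertTensor H K →L[ℂ] HilbertTensor H K) (u v : H) :
    inner ℂ v (sliceLeft x y X u) =
      (∑' n, inner ℂ (hilbertTmul v (y n)) (X (hilbertTmul u (x n))) : ℂ) := by
  have h := (innerSL ℂ v ∘L ContinuousLinearMap.apply ℂ H u).hasSum
    (summable_sliceLeft x y X).of_norm.hasSum
  refine h.tsum_eq.symm.trans (tsum_congr fun n => ?_)
  exact ContinuousLinearMap.adjoint_inner_right _ _ _

theorem inner_sliceLeft_single (x y : K) (X : HilbertTensor H K →L[ℂ] HilbertTensor H K)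
    (u v : H) :
    inner ℂ v (sliceLeft (lp.single 2 0 x) (lp.single 2 0 y) X u) =
      (inner ℂ (hilbertTmul v y) (X (hilbertTmul u x)) : ℂ) := by
  rw [inner_sliceLeft, tsum_eq_single 0]
  · simp
  · intro n hn
    simp [lp.single_apply, hn]

theorem normalFunctional_sliceLeft (x y : lp (fun _ : ℕ => K) 2) (u v : lp (fun _ : ℕ => H) 2)
    (X : HilbertTensor H K →L[ℂ] HilbertTensor H K) :
    normalFunctional u v (sliceLeft x y X) = ∑' i : ℕ × ℕ,
      inner ℂ (hilbertTmul (v i.1) (y i.2)) (X (hilbertTmul (u i.1) (x i.2))) := by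
  rw [(summable_inner_apply (summable_norm_hilbertTmul_sq u x) (summable_norm_hilbertTmul_sq v y)
    X).tsum_prod]
  exact tsum_congr fun n => inner_sliceLeft x y X _ _

theorem normalFunctional_sliceRight (x y : lp (fun _ : ℕ => H) 2) (u v : lp (fun _ : ℕ => K) 2)
    (X : HilbertTensor H K →L[ℂ] HilbertTensor H K) :
    normalFunctional u v (sliceRight x y X) = ∑' i : ℕ × ℕ,
      inner ℂ (hilbertTmul (y i.1) (v i.2)) (X (hilbertTmul (x i.1) (u i.2))) := by
  have hs := summable_inner_apply (summable_norm_hilbertTmul_sq x u)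
    (summable_norm_hilbertTmul_sq y v) X
  refine Eq.trans ?_ ((Equiv.prodComm ℕ ℕ).tsum_eq _)
  refine Eq.trans ?_ ((Equiv.prodComm ℕ ℕ).summable_iff.2 hs).tsum_prod.symm
  exact tsum_congr fun n => inner_sliceRight x y X _ _

theorem continuous_sliceLeft (x y : lp (fun _ : ℕ => K) 2) :
    Continuous[weakStar (HilbertTensor H K), weakStar H] (sliceLeft (H := H) x y) := by
  refine @continuous_weakStar_rng _ _ _ _ (weakStar _) _ fun u v => ?_
  simp only [normalFunctional_sliceLeft]
  exact continuous_tsum_inner_weakStar (summable_norm_hilbertTmul_sq u x)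
    (summable_norm_hilbertTmul_sq v y)

theorem continuous_sliceRight (x y : lp (fun _ : ℕ => H) 2) :
    Continuous[weakStar (HilbertTensor H K), weakStar K] (sliceRight (K := K) x y) := by
  refine @continuous_weakStar_rng _ _ _ _ (weakStar _) _ fun u v => ?_
  simp only [normalFunctional_sliceRight]
  exact continuous_tsum_inner_weakStar (summable_norm_hilbertTmul_sq x u)
    (summable_norm_hilbertTmul_sq y v)

theorem sliceLeft_tensorOperator (x y : lp (fun _ : ℕ => K) 2) (A : H →L[ℂ] H) (B : K →L[ℂ] K) :
    sliceLeft x y (tensorOperator A B) = normalFunctional x y B • A := by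
  ext u
  refine ext_inner_left ℂ fun v => ?_
  rw [inner_sliceLeft, smul_apply, inner_smul_right, normalFunctional, ← tsum_mul_right]
  exact tsum_congr fun n => by
    rw [tensorOperator_hilbertTmul, inner_hilbertTmul, mul_comm]

theorem sliceRight_tensorOperator (x y : lp (fun _ : ℕ => H) 2) (A : H →L[ℂ] H) (B : K →L[ℂ] K) :
    sliceRight x y (tensorOperator A B) = normalFunctional x y A • B := by
  ext u
  refine ext_inner_left ℂ fun v => ?_
  rw [inner_sliceRight, smul_apply, inner_smul_right, normalFunctional, ← tsum_mul_right]
  exact tsum_congr fun n => by rw [tensorOperator_hilbertTmul, inner_hilbertTmul]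

/-- `sliceLeft` as a linear map. -/
def sliceLeftₗ (x y : lp (fun _ : ℕ => K) 2) :
    (HilbertTensor H K →L[ℂ] HilbertTensor H K) →ₗ[ℂ] (H →L[ℂ] H) where
  toFun := sliceLeft x y
  map_add' X Y := by
    rw [sliceLeft, sliceLeft, sliceLeft,
      ← (summable_sliceLeft x y X).of_norm.tsum_add (summable_sliceLeft x y Y).of_norm]
    exact tsum_congr fun n => by rw [ContinuousLinearMap.add_comp, ContinuousLinearMap.comp_add]
  map_smul' c X := by
    rw [sliceLeft, sliceLeft, RingHom.id_apply, ← tsum_const_smul'']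
    exact tsum_congr fun n => by rw [ContinuousLinearMap.smul_comp, ContinuousLinearMap.comp_smul]

/-- `sliceRight` as a linear map. -/
def sliceRightₗ (x y : lp (fun _ : ℕ => H) 2) :
    (HilbertTensor H K →L[ℂ] HilbertTensor H K) →ₗ[ℂ] (K →L[ℂ] K) where
  toFun := sliceRight x y
  map_add' X Y := by
    rw [sliceRight, sliceRight, sliceRight,
      ← (summable_sliceRight x y X).of_norm.tsum_add (summable_sliceRight x y Y).of_norm]
    exact tsum_congr fun n => by rw [ContinuousLinearMap.add_comp, ContinuousLinearMap.comp_add]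
  map_smul' c X := by
    rw [sliceRight, sliceRight, RingHom.id_apply, ← tsum_const_smul'']
    exact tsum_congr fun n => by rw [ContinuousLinearMap.smul_comp, ContinuousLinearMap.comp_smul]

/-- The Fubini product contains the elementary tensors and is weak*-closed, because slice maps are
weak*-continuous and `S`, `T` are weak*-closed. -/
theorem normalTensorProduct_subset_fubiniTensorProduct {S : Submodule ℂ (H →L[ℂ] H)}
    {T : Submodule ℂ (K →L[ℂ] K)} (hS : IsClosed[weakStar H] (S : Set (H →L[ℂ] H)))
    (hT : IsClosed[weakStar K] (T : Set (K →L[ℂ] K))) :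
    normalTensorProduct S T ⊆ fubiniTensorProduct S T := by
  refine @closure_minimal _ (weakStar _) _ _ (fun X hX => ⟨fun x y => ?_, fun x y => ?_⟩) ?_
  · suffices h : Submodule.span ℂ {X | ∃ A ∈ S, ∃ B ∈ T, X = tensorOperator A B} ≤
        T.comap (sliceRightₗ x y) from h hX
    refine Submodule.span_le.2 ?_
    rintro _ ⟨A, hA, B, hB, rfl⟩
    change sliceRight x y (tensorOperator A B) ∈ T
    rw [sliceRight_tensorOperator]
    exact T.smul_mem _ hB
  · suffices h : Submodule.span ℂ {X | ∃ A ∈ S, ∃ B ∈ T, X = tensorOperator A B} ≤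
        S.comap (sliceLeftₗ x y) from h hX
    refine Submodule.span_le.2 ?_
    rintro _ ⟨A, hA, B, hB, rfl⟩
    change sliceLeft x y (tensorOperator A B) ∈ S
    rw [sliceLeft_tensorOperator]
    exact S.smul_mem _ hA
  · have h : fubiniTensorProduct S T =
        (⋂ (x) (y), sliceRight x y ⁻¹' (T : Set (K →L[ℂ] K))) ∩
        ⋂ (x) (y), sliceLeft x y ⁻¹' (S : Set (H →L[ℂ] H)) := by
      ext X
      simp [fubiniTensorProduct]
    rw [h]
    refine @IsClosed.inter _ _ _ (weakStar _) ?_ ?_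
    · exact @isClosed_iInter _ _ (weakStar _) _ fun x => @isClosed_iInter _ _ (weakStar _) _ fun y =>
        @IsClosed.preimage _ _ (weakStar _) (weakStar _) _ (continuous_sliceRight x y) _ hT
    · exact @isClosed_iInter _ _ (weakStar _) _ fun x => @isClosed_iInter _ _ (weakStar _) _ fun y =>
        @IsClosed.preimage _ _ (weakStar _) (weakStar _) _ (continuous_sliceLeft x y) _ hS

theorem IsGrading.inner_cesaro_tensor {E : ℕ → H →L[ℂ] H} (hE : IsGrading E) (k : ℕ)
    (X : HilbertTensor H K →L[ℂ] HilbertTensor H K) (x y : H) (u v : K) :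
    inner ℂ (hilbertTmul y v) ((hE.tensor K).cesaro k X (hilbertTmul x u)) =
      ((k : ℂ)⁻¹ * ∑' s, inner ℂ (hilbertTmul (windowProj E k s y) v)
        (X (hilbertTmul (windowProj E k s x) u)) : ℂ) := by
  rw [IsGrading.inner_cesaro]
  simp only [windowProj_tensor]

/-- A weak*-closed space that is invariant under the Cesàro maps of a grading, with
finite-dimensional images, has the slice map property. -/
theorem IsGrading.fubiniTensorProduct_eq {E : ℕ → H →L[ℂ] H} (hE : IsGrading E)
    {S : Submodule ℂ (H →L[ℂ] H)} (hS : IsClosed[weakStar H] (S : Set (H →L[ℂ] H)))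
    (W : ℕ → Submodule ℂ (H →L[ℂ] H)) [∀ k, FiniteDimensional ℂ (W k)] (hWS : ∀ k, W k ≤ S)
    (hW : ∀ k, ∀ A ∈ S, hE.cesaro k A ∈ W k)
    {T : Submodule ℂ (K →L[ℂ] K)} (hT : IsClosed[weakStar K] (T : Set (K →L[ℂ] K))) :
    fubiniTensorProduct S T = normalTensorProduct S T := by
  refine Set.Subset.antisymm (fun X hX => ?_) (normalTensorProduct_subset_fubiniTensorProduct hS hT)
  refine @mem_closure_of_tendsto _ (weakStar _) _ _ _ _ _ _ ((hE.tensor K).tendsto_cesaro X)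
    (.of_forall fun k => ?_)
  have h : (hE.tensor K).cesaro k X ∈
      Submodule.span ℂ {X | ∃ A ∈ W k, ∃ B ∈ T, X = tensorOperator A B} := by
    -- A left slice of the averaged operator is the Cesàro mean of a left slice of `X`, hence in `W
    -- k`. A right slice at `x`, `y` is `1/k` times the right slice of `X` by the square-summable
    -- sequences `Q_s x`, `Q_s y`, hence in `T`.
    refine mem_span_tensorOperator (fun u v => ⟨_, hW k _ (hX.2 (lp.single 2 0 u) (lp.single 2 0 v)),
      fun x y => ?_⟩) fun x y => ⟨(k : ℂ)⁻¹ • sliceRight (hE.windowSeq k x) (hE.windowSeq k y) X,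
        T.smul_mem _ (hX.1 _ _), fun u v => ?_⟩
    · rw [hE.inner_cesaro_tensor, hE.inner_cesaro]
      simp only [inner_sliceLeft_single]
    · rw [hE.inner_cesaro_tensor, smul_apply, inner_smul_right, inner_sliceRight]
      rfl
  refine Submodule.span_mono ?_ h
  rintro _ ⟨A, hA, B, hB, rfl⟩
  exact ⟨A, hWS k hA, B, hB, rfl⟩

end HilbertTensor

end

theorem theorem2p4 (d : ℕ) (J : Submodule ℂ (FockSpace d →L[ℂ] FockSpace d))
    (hJ : IsHomogeneousIdeal J) :
    IsClosed[weakStar (coinvariantSubspace J)]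
      (compressionAlgebra J : Set (coinvariantSubspace J →L[ℂ] coinvariantSubspace J)) ∧
    (∃ Φ : ℕ → compressionAlgebra J →ₗ[ℂ] compressionAlgebra J,
      (∀ k, 1 ≤ k → ∀ (A : FockSpace d →L[ℂ] FockSpace d) (hA : A ∈ freeSemigroupAlgebra d),
        (Φ k ⟨compression J A, compression_mem J hA⟩ :
          coinvariantSubspace J →L[ℂ] coinvariantSubspace J) = compression J (cesaroMap k A)) ∧
      (∀ k, 1 ≤ k → IsCCFiniteRankNormal (Φ k)) ∧
      ∀ B : compressionAlgebra J,
        Filter.Tendsto (fun k => (Φ k B : coinvariantSubspace J →L[ℂ] coinvariantSubspace J))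
          Filter.atTop (@nhds _ (weakStar (coinvariantSubspace J))
            (B : coinvariantSubspace J →L[ℂ] coinvariantSubspace J))) ∧
    HasCCAP (compressionAlgebra J) ∧
    HasPropertySSigma.{0, v} (compressionAlgebra J) := by
  have hclosed := hJ.isWOTClosedIdeal.isClosed_compressionAlgebra
  have hlim (B : compressionAlgebra J) := hJ.isGrading.tendsto_cesaro
    (B : coinvariantSubspace J →L[ℂ] coinvariantSubspace J)
  refine ⟨hclosed, ⟨hJ.cesaro, fun k _ A hA => hJ.cesaro_compression hA k,
    fun k _ => hJ.isCCFiniteRankNormal_cesaro k, hlim⟩,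
    -- The index `0` may stay in the net: as `0⁻¹ = 0`, the map there is zero.
    ⟨ℕ, inferInstance, inferInstance, inferInstance, hJ.cesaro,
      hJ.isCCFiniteRankNormal_cesaro, hlim⟩, ?_⟩
  intro K _ _ _ T hT
  exact hJ.isGrading.fubiniTensorProduct_eq hclosed (compressedPolynomials J)
    compressedPolynomials_le (fun k _ hB => hJ.cesaro_mem_compressedPolynomials k hB) hT
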